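/- Setting. Let $X$ be a standard Borel space. A classifier is a measurable $h:X\to\{-1,+1\}$. Let $C$ be a set of classifiers of finite VC dimension (the largest $k$ such that some $(x_1,\dots,x_k)\in X^k$ is shattered by $C$, i.e. realizes all $2^k$ labellings by elements of $C$). Assume the usual measurability convention: for every $k$, every $y\in\{-1,+1\}^k$ and every probability measure $P$ on $X$, the set $\{(x_1,\dots,x_k): \exists h\in C\ \forall i\ h(x_i)=y_i\}$ is measurable up to a $P^k$-null set; any remaining non-measurable probability or expectation is an outer one. Given a probability measure $P$ and a target $f\in C$, let $X_1,X_2,\dots$ be i.i.d. with law $P$, $Y_i=f(X_i)$, $\mathcal Z_n=((X_1,Y_1),\dots,(X_n,Y_n))$, and $\mathrm{er}(h)=P(x:h(x)\ne f(x))$. Algorithms. A passive algorithm $A$ is a (jointly measurable, possibly randomized) map from finite sequences of labelled examples to classifiers. An active algorithm, given a budget $n$ and the whole sequence $(X_i)$, sequentially requests at most $n$ of the labels $Y_i$ and returns a classifier; it may be randomized. An active meta-algorithm maps each passive algorithm to an active algorithm. A function $\Lambda(\varepsilon,f,P)\in\{1,2,\dots\}\cup\{\infty\}$ is a label complexity achieved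 by a passive (resp. active) algorithm if for all $f\in C$, all $P$, all $\varepsilon\in(0,1)$ and all integers $n\ge\Lambda(\varepsilon,f,P)$, the expected error rate of its output on $\mathcal Z_n$ (resp. with budget $n$) is at most $\varepsilon$. Activizers. $\mathrm{Nontrivial}(\Lambda)$ is the set of pairs $(f,P)$ such that $\Lambda(\varepsilon,f,P)<\infty$ for all $\varepsilon\in(0,1)$, and $g(\varepsilon)=o(\Lambda(\varepsilon,f,P))$ as $\varepsilon\downarrow0$ for every $g\ge0$ with $g(\varepsilon)=O(\log^k(1/\varepsilon))$ for some real $k\ge0$. An active meta-algorithm $M$ is a universal activizer for $C$ if for every passive algorithm $A$ and every label complexity $\Lambda_p$ achieved by $A$, the active algorithm $M(A)$ achieves a label complexity $\Lambda_a$ such that for every $f\in C$ and every $P$ with $(f,P)\in\mathrm{Nontrivial}(\Lambda_p)$ there is $c\in[1,\infty)$ with $\Lambda_a(c\varepsilon,f,P)=o(\Lambda_p(\varepsilon,f,P))$ as $\varepsilon\downarrow0$. For a set $H$ of classifiers let $\mathrm{DIS}(H)=\{x:\exists h_1,h_2\in H,\ h_1(x)\ne h_2(x)\}$. Meta-Algorithm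 0, with inputs $A$ and $n$, does the following. (0) Request $Y_1,\dots,Y_{\lfloor n/2\rfloor}$ and set $t=\lfloor n/2\rfloor$. (1) Let $V$ be the set of $h\in C$ with $h(X_i)=Y_i$ for all $i\le\lfloor n/2\rfloor$. (2) Let $\hat\Delta=\max\{\frac{2}{n^2}\sum_{i=n^2+1}^{2n^2}\mathbf 1[X_i\in\mathrm{DIS}(V)],\ \frac4n\}$. (3) Let $L$ be the empty sequence. (4) For $m=\lfloor n/2\rfloor+1,\dots,\lfloor n/2\rfloor+\lfloor n/(4\hat\Delta)\rfloor$: if $X_m\in\mathrm{DIS}(V)$ and $t<n$, request $Y_m$, let $\hat y=Y_m$ and increase $t$ by $1$; otherwise let $\hat y=h(X_m)$ for an arbitrary $h\in V$; append $(X_m,\hat y)$ to $L$. (5) Return $A(L)$. For $f\in C$ and a probability measure $P$, the disagreement core is $\partial_{C,P}f=\lim_{r\downarrow0}\mathrm{DIS}(\{g\in C:P(x:g(x)\ne f(x))\le r\})$, i.e. the intersection of these sets over all $r>0$. Theorem. However the arbitrary choices of $h\in V$ are made, Meta-Algorithm 0 is a universal activizer for $C$ if and only if $P(\partial_{C,P}f)=0$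 for every $f\in C$ and every probability measure $P$ on $X$. -/

import Mathlib

open MeasureTheory Filter Topology
open scoped ENNReal NNReal

universe u

/-- Outer expectation of a nonnegative quantity that need not be measurable. It is the ordinary
expectation for measurable quantities (`outerExpectation_eq`). -/
noncomputable def outerExpectation {Ω : Type*} [MeasurableSpace Ω] (μ : Measure Ω)
    (φ : Ω → ℝ≥0∞) : ℝ≥0∞ :=
  ⨅ (ψ : Ω → ℝ≥0∞) (_ : Measurable ψ) (_ : ∀ ω, φ ω ≤ ψ ω), ∫⁻ ω, ψ ω ∂μ

theorem outerExpectation_eq {Ω : Type*} [MeasurableSpace Ω] (μ : Measure Ω)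
    (φ : Ω → ℝ≥0∞) (hφ : Measurable φ) : outerExpectation μ φ = ∫⁻ ω, φ ω ∂μ :=
  le_antisymm (iInf₂_le_of_le φ hφ (iInf_le _ fun _ => le_rfl))
    (le_iInf₂ fun _ _ => le_iInf fun h => lintegral_mono h)

/-! ### Classifiers, concept spaces, VC dimension -/

/-- A classifier on `X`: a measurable two-valued function. The labels `+1` and `-1` are
represented by `true` and `false`. -/
abbrev Classifier (X : Type u) [MeasurableSpace X] : Type u :=
  {h : X → Bool // Measurable h}

/-- `H` shatters the finite sequence `S` (the empty sequence is shattered iff `H` is nonempty). -/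
def Shatters {X : Type u} [MeasurableSpace X] (H : Set (Classifier X)) {k : ℕ}
    (S : Fin k → X) : Prop :=
  ∀ y : Fin k → Bool, ∃ h ∈ H, ∀ i, h.1 (S i) = y i

/-- The VC dimension, with value `⊤` if arbitrarily long sequences are shattered. -/
noncomputable def vcDim {X : Type u} [MeasurableSpace X] (H : Set (Classifier X)) : ℕ∞ :=
  ⨆ (k : ℕ) (_ : ∃ S : Fin k → X, Shatters H S), (k : ℕ∞)

/-- A VC class: a set of classifiers of finite VC dimension. -/
def IsVCClass {X : Type u} [MeasurableSpace X] (H : Set (Classifier X)) : Prop :=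
  vcDim H < ⊤

/-- The measurability convention for a concept space: for every labelling `y` of `k` points,
the event that `k` independent examples can be labelled by `y` within `H` is measurable up to
null sets. -/
def HasMeasurableTraces {X : Type u} [MeasurableSpace X] (H : Set (Classifier X)) : Prop :=
  ∀ (k : ℕ) (y : Fin k → Bool) (P : ProbabilityMeasure X),
    NullMeasurableSet {S : Fin k → X | ∃ h ∈ H, ∀ i, h.1 (S i) = y i}
      (Measure.pi fun _ : Fin k => (P : Measure X))

/-- `P (x : h x ≠ f x)`, the error rate of `h` when `f` is the target. -/
noncomputable def errorRate {X : Type u} [MeasurableSpace X] (P : ProbabilityMeasure X)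
    (f h : Classifier X) : ℝ≥0∞ :=
  (P : Measure X) {x | h.1 x ≠ f.1 x}

/-- The empirical error rate on a finite labelled sequence; it is `0` on the empty sequence. -/
noncomputable def empiricalError {X : Type u} [MeasurableSpace X] (h : Classifier X)
    (L : List (X × Bool)) : ℝ :=
  (L.countP fun p => h.1 p.1 != p.2 : ℕ) / (L.length : ℝ)

/-- `H[L]`, the classifiers in `H` with no error on `L`. -/
def versionSpace {X : Type u} [MeasurableSpace X] (H : Set (Classifier X))
    (L : List (X × Bool)) : Set (Classifier X) :=
  {h | h ∈ H ∧ empiricalError h L = 0}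

/-- The region of disagreement `DIS(H)`. -/
def disagreementRegion {X : Type u} [MeasurableSpace X] (H : Set (Classifier X)) : Set X :=
  {x | ∃ h₁ ∈ H, ∃ h₂ ∈ H, h₁.1 x ≠ h₂.1 x}

/-- `B_{H,P}(f, r)`. -/
def classifierBall {X : Type u} [MeasurableSpace X] (H : Set (Classifier X))
    (P : ProbabilityMeasure X) (f : Classifier X) (r : ℝ) : Set (Classifier X) :=
  {g | g ∈ H ∧ errorRate P f g ≤ ENNReal.ofReal r}

/-- The disagreement core `∂_{H,P} f`: the limit of `DIS(B_{H,P}(f, r))` as `r ↓ 0`. These sets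
decrease with `r`, so that the limit is their intersection. -/
def disagreementCore {X : Type u} [MeasurableSpace X] (H : Set (Classifier X))
    (P : ProbabilityMeasure X) (f : Classifier X) : Set X :=
  ⋂ (r : ℝ) (_ : 0 < r), disagreementRegion (classifierBall H P f r)

/-! ### Passive and active learning algorithms -/

/-- A (possibly randomized) passive learning algorithm: it maps a random seed and a finite
sequence of labelled examples to a classifier. -/
structure PassiveAlgorithm (X : Type u) [MeasurableSpace X] where
  Seed : Type
  [measurableSeed : MeasurableSpace Seed]
  law : ProbabilityMeasure Seed
  learn : Seed → List (X × Bool) → Classifier X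
  measurable_learn : ∀ n : ℕ, Measurable fun p : Seed × (Fin n → X × Bool) × X =>
    (learn p.1 (List.ofFn p.2.1)).1 p.2.2

attribute [instance] PassiveAlgorithm.measurableSeed

/-- An interaction that sequentially requests labels (by their index) and finally returns a value.
What is requested next may depend on the labels seen so far and on nothing else. -/
inductive LabelProtocol (α : Type u) : Type u
  | done (a : α) : LabelProtocol α
  | ask (i : ℕ) (next : Bool → LabelProtocol α) : LabelProtocol α

namespace LabelProtocol

def bind {α β : Type u} : LabelProtocol α → (α → LabelProtocol β) → LabelProtocol β
  | done a, k => k a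
  | ask i next, k => ask i fun b => (next b).bind k

/-- The returned value when the `i`-th label is `y i`. -/
def run {α : Type u} (y : ℕ → Bool) : LabelProtocol α → α
  | done a => a
  | ask i next => (next (y i)).run y

/-- The number of labels requested when the `i`-th label is `y i`. -/
def requests {α : Type u} (y : ℕ → Bool) : LabelProtocol α → ℕ
  | done _ => 0
  | ask i next => (next (y i)).requests y + 1

theorem requests_bind {α β : Type u} (y : ℕ → Bool) (p : LabelProtocol α)
    (k : α → LabelProtocol β) :
    (p.bind k).requests y = p.requests y + (k (p.run y)).requests y := by
  induction p with
  | done a => simp [bind, run, requests]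
  | ask i next ih => simp only [bind, run, requests, ih]; omega

end LabelProtocol

/-- A (possibly randomized) active learning algorithm: given a label budget `n`, a random seed and
the sequence of unlabelled examples, it requests at most `n` labels and returns a classifier. -/
structure ActiveAlgorithm (X : Type u) [MeasurableSpace X] where
  Seed : Type
  [measurableSeed : MeasurableSpace Seed]
  law : ProbabilityMeasure Seed
  protocol : ℕ → Seed → (ℕ → X) → LabelProtocol (Classifier X)
  requests_le : ∀ (n : ℕ) (s : Seed) (x : ℕ → X) (y : ℕ → Bool),
    (protocol n s x).requests y ≤ n

attribute [instance] ActiveAlgorithm.measurableSeed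

/-- An active meta-algorithm turns a passive algorithm into an active one. -/
abbrev ActiveMetaAlgorithm (X : Type u) [MeasurableSpace X] : Type (max u 1) :=
  PassiveAlgorithm X → ActiveAlgorithm X

/-- The law of the i.i.d. sequence of unlabelled examples with common distribution `P`; the
coordinate `x i` is the `(i + 1)`-st example. -/
noncomputable def sampleLaw {X : Type u} [MeasurableSpace X] (P : ProbabilityMeasure X) :
    Measure (ℕ → X) :=
  Measure.infinitePi fun _ : ℕ => (P : Measure X)

/-- Expected error rate of `A` run on the first `n` examples labelled by the target `f`. -/
noncomputable def PassiveAlgorithm.expectedError {X : Type u} [MeasurableSpace X]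
    (A : PassiveAlgorithm X) (f : Classifier X) (P : ProbabilityMeasure X) (n : ℕ) : ℝ≥0∞ :=
  ∫⁻ ω, errorRate P f (A.learn ω.2 (List.ofFn fun i : Fin n => (ω.1 i, f.1 (ω.1 i))))
    ∂((sampleLaw P).prod (A.law : Measure A.Seed))

/-- Expected error rate of `A` run with label budget `n` when the target is `f`. -/
noncomputable def ActiveAlgorithm.expectedError {X : Type u} [MeasurableSpace X]
    (A : ActiveAlgorithm X) (f : Classifier X) (P : ProbabilityMeasure X) (n : ℕ) : ℝ≥0∞ :=
  outerExpectation ((sampleLaw P).prod (A.law : Measure A.Seed)) fun ω =>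
    errorRate P f ((A.protocol n ω.2 ω.1).run fun i => f.1 (ω.1 i))

/-! ### Label complexity and activizers -/

/-- Label complexities `Λ(ε, f, P)`; only the values at `ε ∈ (0, 1)` are meaningful. -/
abbrev LabelComplexity (X : Type u) [MeasurableSpace X] : Type u :=
  ℝ → Classifier X → ProbabilityMeasure X → ℕ∞

/-- `Λ` is a (positive) label complexity achieved, for targets in `C`, by an algorithm with
expected error rate `err f P n` on `n` labels. -/
def AchievesLabelComplexity {X : Type u} [MeasurableSpace X] (C : Set (Classifier X))
    (err : Classifier X → ProbabilityMeasure X → ℕ → ℝ≥0∞) (Λ : LabelComplexity X) : Prop :=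
  ∀ f ∈ C, ∀ P : ProbabilityMeasure X, ∀ ε ∈ Set.Ioo (0 : ℝ) 1,
    0 < Λ ε f P ∧ ∀ n : ℕ, Λ ε f P ≤ (n : ℕ∞) → err f P n ≤ ENNReal.ofReal ε

/-- `a(ε) = o(b(ε))` as `ε ↓ 0`, i.e. `b(ε) = ω(a(ε))`. -/
def LittleO (a b : ℝ → ℝ≥0∞) : Prop :=
  Tendsto (fun ε => a ε / b ε) (𝓝[>] 0) (𝓝 0)

/-- The class `Polylog(1/ε)`. -/
def Polylog : Set (ℝ → ℝ≥0) :=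
  {g | ∃ k : ℝ, 0 ≤ k ∧
    (fun ε => (g ε : ℝ)) =O[𝓝[>] 0] fun ε => Real.log (1 / ε) ^ k}

/-- `Nontrivial(Λ)`: the pairs at which `Λ` is finite and `ω(g)` for every polylogarithmic `g`. -/
def NontrivialPairs {X : Type u} [MeasurableSpace X] (Λ : LabelComplexity X) :
    Set (Classifier X × ProbabilityMeasure X) :=
  {q | (∀ ε ∈ Set.Ioo (0 : ℝ) 1, Λ ε q.1 q.2 < ⊤) ∧
    ∀ g ∈ Polylog, LittleO (fun ε => (g ε : ℝ≥0∞)) fun ε => (Λ ε q.1 q.2 : ℝ≥0∞)}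

/-- The active meta-algorithm `M` activizes the passive algorithm `A` for `C`. -/
def Activizes {X : Type u} [MeasurableSpace X] (M : ActiveMetaAlgorithm X)
    (A : PassiveAlgorithm X) (C : Set (Classifier X)) : Prop :=
  ∀ Λp : LabelComplexity X, AchievesLabelComplexity C A.expectedError Λp →
    ∃ Λa : LabelComplexity X, AchievesLabelComplexity C (M A).expectedError Λa ∧
      ∀ f ∈ C, ∀ P : ProbabilityMeasure X, (f, P) ∈ NontrivialPairs Λp →
        ∃ c : ℝ, 1 ≤ c ∧
          LittleO (fun ε => (Λa (c * ε) f P : ℝ≥0∞)) fun ε => (Λp ε f P : ℝ≥0∞)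

/-- `M` activizes every passive algorithm for `C`. -/
def IsUniversalActivizer {X : Type u} [MeasurableSpace X] (M : ActiveMetaAlgorithm X)
    (C : Set (Classifier X)) : Prop :=
  ∀ A : PassiveAlgorithm X, Activizes M A C

/-! ### The two-batch disagreement-based meta-algorithm

Examples are numbered from `0`: the coordinate `x i` is the example `X_{i+1}`. -/

/-- The arbitrary choice of a classifier in the version space `V`. It may depend on the budget, the
unlabelled examples, the index of the current example and the sample constructed so far. -/
structure SelectionRule (X : Type u) [MeasurableSpace X] where
  pick : (n : ℕ) → (x : ℕ → X) → (V : Set (Classifier X)) → (m : ℕ) → (L : List (X × Bool)) →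
    Classifier X
  pick_mem : ∀ n x V m L, V.Nonempty → pick n x V m L ∈ V

/-- Request the first `k` labels, and return the first `k` labelled examples. -/
def requestFirst {X : Type u} (x : ℕ → X) : ℕ → LabelProtocol (List (X × Bool))
  | 0 => .done []
  | k + 1 => (requestFirst x k).bind fun L => .ask k fun y => .done (L ++ [(x k, y)])

open Classical in
/-- The estimator `max {(2 / n²) ∑_{n² < i ≤ 2n²} 1_D(X_i), 4 / n}` of the probability of `D`. -/
noncomputable def probEstimate {X : Type u} (n : ℕ) (x : ℕ → X) (D : Set X) : ℝ :=
  max (2 / (n : ℝ) ^ 2 * ∑ i ∈ Finset.Ico (n ^ 2) (2 * n ^ 2), if x i ∈ D then (1 : ℝ) else 0)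
    (4 / n)

open Classical in
/-- The loop of the second batch: `K` examples remain, starting with `x m`; `t` labels have been
requested; `L` is the sample constructed so far. -/
noncomputable def secondBatch {X : Type u} [MeasurableSpace X] (n : ℕ) (x : ℕ → X) (D : Set X)
    (infer : ℕ → List (X × Bool) → Classifier X) :
    (K m t : ℕ) → List (X × Bool) → LabelProtocol (List (X × Bool))
  | 0, _, _, L => .done L
  | K + 1, m, t, L =>
    if x m ∈ D ∧ t < n then
      .ask m fun y => secondBatch n x D infer K (m + 1) (t + 1) (L ++ [(x m, y)])
    else
      secondBatch n x D infer K (m + 1) t (L ++ [(x m, (infer m L).1 (x m))])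

/-- The label requests of the meta-algorithm; the result is the sample given to the passive
algorithm. -/
noncomputable def metaAlgorithm0Sample {X : Type u} [MeasurableSpace X] (C : Set (Classifier X))
    (σ : SelectionRule X) (n : ℕ) (x : ℕ → X) : LabelProtocol (List (X × Bool)) :=
  (requestFirst x (n / 2)).bind fun L₀ =>
    let V := versionSpace C L₀
    let Δ := probEstimate n x (disagreementRegion V)
    secondBatch n x (disagreementRegion V) (σ.pick n x V) ⌊(n : ℝ) / (4 * Δ)⌋₊ (n / 2) (n / 2) []

theorem requests_requestFirst {X : Type u} (x : ℕ → X) (y : ℕ → Bool) (k : ℕ) :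
    (requestFirst x k).requests y = k := by
  induction k with
  | zero => rfl
  | succ k ih => simp [requestFirst, LabelProtocol.requests_bind, ih, LabelProtocol.requests]

theorem requests_secondBatch_le {X : Type u} [MeasurableSpace X] (n : ℕ) (x : ℕ → X) (D : Set X)
    (infer : ℕ → List (X × Bool) → Classifier X) (y : ℕ → Bool) (K m t : ℕ)
    (L : List (X × Bool)) :
    (secondBatch n x D infer K m t L).requests y ≤ n - t := by
  induction K generalizing m t L with
  | zero => simp [secondBatch, LabelProtocol.requests]
  | succ K ih =>
    rw [secondBatch]
    split_ifs with h
    · have := ih (m + 1) (t + 1) (L ++ [(x m, y m)])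
      simp only [LabelProtocol.requests]
      omega
    · exact ih _ _ _

/-- Meta-Algorithm 0 for the concept space `C`, where `σ` makes the arbitrary choices. -/
noncomputable def metaAlgorithm0 {X : Type u} [MeasurableSpace X] (C : Set (Classifier X))
    (σ : SelectionRule X) : ActiveMetaAlgorithm X := fun A =>
  { Seed := A.Seed
    law := A.law
    protocol := fun n s x =>
      (metaAlgorithm0Sample C σ n x).bind fun L => .done (A.learn s L)
    requests_le := by
      intro n s x y
      simp only [metaAlgorithm0Sample, LabelProtocol.requests_bind, LabelProtocol.requests,
        requests_requestFirst]
      have := requests_secondBatch_le n x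
        (disagreementRegion (versionSpace C ((requestFirst x (n / 2)).run y)))
        (σ.pick n x (versionSpace C ((requestFirst x (n / 2)).run y))) y
        ⌊(n : ℝ) / (4 * probEstimate n x
          (disagreementRegion (versionSpace C ((requestFirst x (n / 2)).run y))))⌋₊
        (n / 2) (n / 2) []
      omega }

/-! Sufficiency of null cores. Sauer's lemma and symmetrization with a ghost sample
(`sampleLaw_doubleSampleEvent_le`, `sampleLaw_inaccurateEvent_le`) show that almost surely the
version space eventually enters every ball about the target `f`. Its region of disagreement
therefore decreases, up to a null set, into the core, and the expected measure of the region tends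
to 0 (`tendsto_prod_sampleDisagreement`). So some fixed number of labels brings this measure below η
with probability at least 1/2, and independent blocks of labels make the failure probability
exponentially small in the budget. Chernoff bounds for the estimator and for the number of requests
complete the failure event (`exists_sampleLaw_failureEvent_le`).

Off that event the passive algorithm receives at least ⌊n/(32η)⌋ examples, all correctly labelled.
Their number is determined by examples outside the batch, so conditioning on it leaves the batch
i.i.d.; the error is at most that of the passive algorithm plus exp(-cn)
(`expectedError_metaAlgorithm0_le`). With η = δ/32, any budget of at least δΛ_p(ε) gives error at
most 2ε for small ε: a nontrivial Λ_p exceeds every multiple of log(1/ε), so the exponential term is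
at most ε. Here δ is arbitrary.

Necessity. Let the core of `f` have measure p > 0. The passive algorithm `decayingAlgorithm` knows
`f` and spoils its answer with probability 1/k on k examples, so ⌈1/ε⌉ labels suffice for the target
`f`. A finite sample is fitted by classifiers arbitrarily close to `f`, so each core point almost
surely stays in the region of disagreement. Hence with probability at least p/2 the estimate is at
least p and the constructed sample has length at most n/p, which forces error at least p²/(2n)
(`le_expectedError_decayingAlgorithm`). Passive and active label complexities are then of the same
order. -/

/-! ### Null-measurable sets in products -/

section NullMeasurableProd

variable {α β : Type*} [MeasurableSpace α] [MeasurableSpace β] {μ : Measure α} {ν : Measure β}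

theorem MeasureTheory.NullMeasurableSet.ae_prodMk_left [SFinite ν] {T : Set (α × β)}
    (hT : NullMeasurableSet T (μ.prod ν)) :
    ∀ᵐ x ∂μ, NullMeasurableSet (Prod.mk x ⁻¹' T) ν := by
  obtain ⟨T', -, hT'm, hT'e⟩ := hT.exists_measurable_superset_ae_eq
  have h := Measure.ae_ae_of_ae_prod (p := fun z => z ∈ T' ↔ z ∈ T)
    (hT'e.mono fun z hz => Iff.of_eq hz)
  filter_upwards [h] with x hx
  have h' : NullMeasurableSet (Prod.mk x ⁻¹' T') ν :=
    (measurable_prodMk_left hT'm).nullMeasurableSet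
  exact h'.congr (hx.mono fun y hy => propext hy)

theorem ae_measure_prodMk_left_eq [SFinite ν] {T T' : Set (α × β)}
    (h : T' =ᵐ[μ.prod ν] T) :
    (fun x => ν (Prod.mk x ⁻¹' T')) =ᵐ[μ] fun x => ν (Prod.mk x ⁻¹' T) := by
  have h := Measure.ae_ae_of_ae_prod (p := fun z => z ∈ T' ↔ z ∈ T)
    (h.mono fun z hz => Iff.of_eq hz)
  filter_upwards [h] with x hx
  exact measure_congr (hx.mono fun y hy => propext hy)

theorem MeasureTheory.NullMeasurableSet.aemeasurable_measure_prodMk_left [SFinite ν]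
    {T : Set (α × β)} (hT : NullMeasurableSet T (μ.prod ν)) :
    AEMeasurable (fun x => ν (Prod.mk x ⁻¹' T)) μ := by
  obtain ⟨T', -, hT'm, hT'e⟩ := hT.exists_measurable_superset_ae_eq
  exact (measurable_measure_prodMk_left hT'm).aemeasurable.congr (ae_measure_prodMk_left_eq hT'e)

theorem MeasureTheory.NullMeasurableSet.prod_apply [SFinite ν] {T : Set (α × β)}
    (hT : NullMeasurableSet T (μ.prod ν)) :
    μ.prod ν T = ∫⁻ x, ν (Prod.mk x ⁻¹' T) ∂μ := by
  obtain ⟨T', -, hT'm, hT'e⟩ := hT.exists_measurable_superset_ae_eq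
  rw [← measure_congr hT'e, Measure.prod_apply hT'm,
    lintegral_congr_ae (ae_measure_prodMk_left_eq hT'e)]

end NullMeasurableProd

/-! ### Bounds for outer expectations. -/

/-- The outer expectation is at least the lower integral. -/
theorem lintegral_le_outerExpectation {Ω : Type*} [MeasurableSpace Ω] (μ : Measure Ω)
    (φ : Ω → ℝ≥0∞) : ∫⁻ ω, φ ω ∂μ ≤ outerExpectation μ φ :=
  le_iInf₂ fun _ _ => le_iInf fun h => lintegral_mono h

/-- The infimum runs over measurable functions that dominate everywhere, so a measurable version of
`g` is raised to `⊤` on a measurable null set containing all exceptional points. -/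
theorem outerExpectation_le_of_aemeasurable {Ω : Type*} [MeasurableSpace Ω] {μ : Measure Ω}
    {φ g : Ω → ℝ≥0∞} (hg : AEMeasurable g μ) (h : φ ≤ᵐ[μ] g) :
    outerExpectation μ φ ≤ ∫⁻ ω, g ω ∂μ := by
  classical
  obtain ⟨N, hN, hNm, hN0⟩ := exists_measurable_superset_of_null
    (ae_iff.1 (h.and hg.ae_eq_mk))
  refine (iInf₂_le_of_le (fun ω => if ω ∈ N then ⊤ else hg.mk g ω)
    (Measurable.ite hNm measurable_const hg.measurable_mk) (iInf_le_of_le ?_ ?_))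
  · intro ω
    by_cases hω : ω ∈ N
    · simp [hω]
    · have : φ ω ≤ g ω ∧ g ω = hg.mk g ω := by
        by_contra h'
        exact hω (hN h')
      simpa [hω, ← this.2] using this.1
  · refine le_of_eq (lintegral_congr_ae ?_)
    filter_upwards [measure_eq_zero_iff_ae_notMem.1 hN0, hg.ae_eq_mk] with ω h1 h2
    simp [h1, h2]

/-! ### The i.i.d. sequence -/

section SampleLaw

variable {X : Type u} [MeasurableSpace X] (P : ProbabilityMeasure X)

instance : IsProbabilityMeasure (sampleLaw P) := by
  unfold sampleLaw; infer_instance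

theorem measurePreserving_eval_sampleLaw (i : ℕ) :
    MeasurePreserving (fun ω : ℕ → X => ω i) (sampleLaw P) (P : Measure X) :=
  measurePreserving_eval_infinitePi (fun _ : ℕ => (P : Measure X)) i

theorem measurePreserving_reindex {j : ℕ → ℕ} (hj : Function.Injective j) :
    MeasurePreserving (fun (ω : ℕ → X) i => ω (j i)) (sampleLaw P) (sampleLaw P) :=
  ⟨by fun_prop, Measure.map_infinitePi_infinitePi_of_inj (P := fun _ : ℕ => (P : Measure X)) hj⟩

theorem measurePreserving_reindex_fin {k : ℕ} {j : Fin k → ℕ} (hj : Function.Injective j) :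
    MeasurePreserving (fun (ω : ℕ → X) i => ω (j i)) (sampleLaw P)
      (Measure.pi fun _ : Fin k => (P : Measure X)) :=
  ⟨by fun_prop, by
    rw [← Measure.infinitePi_eq_pi]
    exact Measure.map_infinitePi_infinitePi_of_inj (P := fun _ : ℕ => (P : Measure X)) hj⟩

/-- The sequence that agrees with `p.1` on `J` and with `p.2` off `J`. -/
def mergeSeq (J : Set ℕ) [DecidablePred (· ∈ J)] (p : (ℕ → X) × (ℕ → X)) : ℕ → X :=
  fun i => if i ∈ J then p.1 i else p.2 i

theorem measurePreserving_mergeSeq (J : Set ℕ) [DecidablePred (· ∈ J)] :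
    MeasurePreserving (mergeSeq (X := X) J) ((sampleLaw P).prod (sampleLaw P)) (sampleLaw P) := by
  have hm : Measurable (mergeSeq (X := X) J) := by
    refine measurable_pi_lambda _ fun i => ?_
    by_cases h : i ∈ J
    · simp only [mergeSeq, h, if_true]; fun_prop
    · simp only [mergeSeq, h, if_false]; fun_prop
  refine ⟨hm, Measure.eq_infinitePi _ fun s t ht => ?_⟩
  rw [Measure.map_apply hm (MeasurableSet.pi s.countable_toSet fun i _ => ht i)]
  have : mergeSeq J ⁻¹' (Set.pi s t) =
      Set.pi (s.filter (· ∈ J) : Finset ℕ) t ×ˢ Set.pi (s.filter (· ∉ J) : Finset ℕ) t := by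
    ext ⟨ω, ω'⟩
    simp only [Set.mem_preimage, Set.mem_pi, Set.mem_prod, Finset.mem_coe, Finset.mem_filter,
      mergeSeq]
    constructor
    · intro h
      refine ⟨fun i hi => ?_, fun i hi => ?_⟩
      · simpa [hi.2] using h i hi.1
      · simpa [hi.2] using h i hi.1
    · rintro ⟨h1, h2⟩ i hi
      by_cases hJ : i ∈ J
      · simpa [hJ] using h1 i ⟨hi, hJ⟩
      · simpa [hJ] using h2 i ⟨hi, hJ⟩
  rw [this, Measure.prod_prod, sampleLaw, Measure.infinitePi_pi _ fun i _ => ht i,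
    Measure.infinitePi_pi _ fun i _ => ht i, Finset.prod_filter_mul_prod_filter_not]

/-- A fresh point may be written into coordinate `k`; this turns statements about a sample and an
independent test point into statements about one sequence. It is the merge map off `{k}`, with only
one coordinate of the second sequence used. -/
theorem measurePreserving_update (k : ℕ) :
    MeasurePreserving (fun p : (ℕ → X) × X => Function.update p.1 k p.2)
      ((sampleLaw P).prod (P : Measure X)) (sampleLaw P) := by
  classical
  have h1 := (MeasurePreserving.id (sampleLaw P)).prod (measurePreserving_eval_sampleLaw P k)
  have h2 := measurePreserving_mergeSeq P {i | i ≠ k}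
  have hm : Measurable (fun p : (ℕ → X) × X => Function.update p.1 k p.2) := by
    refine measurable_pi_lambda _ fun i => ?_
    by_cases h : i = k
    · subst h; simpa using measurable_snd
    · simp only [Function.update_of_ne h]; fun_prop
  refine ⟨hm, ?_⟩
  rw [← h1.map_eq, Measure.map_map hm h1.measurable]
  refine Eq.trans ?_ h2.map_eq
  congr 1
  ext p i
  by_cases h : i = k
  · subst h; simp [mergeSeq]
  · simp [mergeSeq, h]

/-- The law of the sequence is unchanged when the coordinates off `J` are resampled. -/
theorem sampleLaw_apply_merge (J : Set ℕ) [DecidablePred (· ∈ J)] {A : Set (ℕ → X)}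
    (hA : NullMeasurableSet A (sampleLaw P)) :
    sampleLaw P A = ∫⁻ ω, sampleLaw P {ω' | mergeSeq J (ω, ω') ∈ A} ∂(sampleLaw P) := by
  rw [← (measurePreserving_mergeSeq P J).measure_preimage hA]
  exact (hA.preimage (measurePreserving_mergeSeq P J).quasiMeasurePreserving).prod_apply

/-- Independence of events that are only null-measurable: the merge map pulls `A ∩ B` back to the
rectangle `A ×ˢ B`. -/
theorem sampleLaw_inter_of_disjoint (J : Set ℕ) {A B : Set (ℕ → X)}
    (hA : NullMeasurableSet A (sampleLaw P)) (hB : NullMeasurableSet B (sampleLaw P))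
    (hAJ : ∀ ω ω' : ℕ → X, (∀ i ∈ J, ω i = ω' i) → (ω ∈ A ↔ ω' ∈ A))
    (hBJ : ∀ ω ω' : ℕ → X, (∀ i ∉ J, ω i = ω' i) → (ω ∈ B ↔ ω' ∈ B)) :
    sampleLaw P (A ∩ B) = sampleLaw P A * sampleLaw P B := by
  classical
  rw [← Measure.prod_prod, ← (measurePreserving_mergeSeq P J).measure_preimage (hA.inter hB)]
  congr 1
  ext ⟨ω, ω'⟩
  have h1 := hAJ (mergeSeq J (ω, ω')) ω fun i hi => by simp [mergeSeq, hi]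
  have h2 := hBJ (mergeSeq J (ω, ω')) ω' fun i hi => by simp [mergeSeq, hi]
  simp [h1, h2]

open Classical in
/-- The number of indices in `I` at which the sequence hits `D`. -/
noncomputable def hitCount (I : Finset ℕ) (D : Set X) (ω : ℕ → X) : ℕ :=
  (I.filter fun i => ω i ∈ D).card

omit [MeasurableSpace X] in
theorem hitCount_mono (I : Finset ℕ) {D D' : Set X} (h : D ⊆ D') (ω : ℕ → X) :
    hitCount I D ω ≤ hitCount I D' ω :=
  Finset.card_le_card fun i hi => by
    simp only [Finset.mem_filter] at hi ⊢
    exact ⟨hi.1, h hi.2⟩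

/-- A Chernoff bound for the number of hits, with both tails according to the sign of `s`. -/
theorem sampleLaw_hitCount_le {D : Set X} (hD : MeasurableSet D) (I : Finset ℕ) (s c : ℝ) :
    sampleLaw P {ω | c ≤ s * hitCount I D ω} ≤
      ENNReal.ofReal (Real.exp ((Real.exp s - 1) * (P : Measure X).real D * I.card - c)) := by
  classical
  set p := (P : Measure X).real D with hp
  let g : X → ℝ≥0∞ := fun x => if x ∈ D then ENNReal.ofReal (Real.exp s) else 1
  have hg : Measurable g := Measurable.ite hD measurable_const measurable_const
  have hgi : ∫⁻ x, g x ∂(P : Measure X) ≤ ENNReal.ofReal (Real.exp ((Real.exp s - 1) * p)) := by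
    have h1 : ∫⁻ x, g x ∂(P : Measure X) =
        ENNReal.ofReal (Real.exp s) * (P : Measure X) D + (P : Measure X) Dᶜ := by
      rw [← lintegral_add_compl _ hD,
        setLIntegral_congr_fun hD (g := fun _ => ENNReal.ofReal (Real.exp s))
          (fun x hx => by simp [g, hx]),
        setLIntegral_congr_fun hD.compl (g := fun _ => 1) (fun x hx => by
          have : x ∉ D := hx
          simp [g, this])]
      simp
    have h2 : (P : Measure X) D = ENNReal.ofReal p := by simp [hp]
    have h3 : (P : Measure X) Dᶜ = ENNReal.ofReal (1 - p) := by
      rw [prob_compl_eq_one_sub hD, h2, ← ENNReal.ofReal_one, ENNReal.ofReal_sub _ (by positivity)]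
    have hp1 : p ≤ 1 := measureReal_le_one
    rw [h1, h2, h3, ← ENNReal.ofReal_mul (by positivity), ← ENNReal.ofReal_add
      (by positivity) (by linarith)]
    refine ENNReal.ofReal_le_ofReal ?_
    -- The moment generating function of a Bernoulli variable, 1 + (e^s - 1)p, is at most exp((e^s -
    -- 1)p).
    have := Real.add_one_le_exp ((Real.exp s - 1) * p)
    linarith
  have hind := ProbabilityTheory.lintegral_prod_eq_prod_lintegral_of_indepFun
    (μ := sampleLaw P) I (fun i ω => g (ω i))
    (ProbabilityTheory.iIndepFun_infinitePi (P := fun _ : ℕ => (P : Measure X))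
      (X := fun _ => g) fun _ => hg) (fun i => hg.comp (measurable_pi_apply i))
  have hprod : ∀ ω : ℕ → X, ∏ i ∈ I, g (ω i) =
      ENNReal.ofReal (Real.exp (s * hitCount I D ω)) := by
    intro ω
    simp only [g]
    rw [Finset.prod_ite, Finset.prod_const_one, mul_one, Finset.prod_const,
      ← ENNReal.ofReal_pow (by positivity), ← Real.exp_nat_mul, mul_comm]
    rfl
  have hbound : ∫⁻ ω, ENNReal.ofReal (Real.exp (s * hitCount I D ω)) ∂(sampleLaw P) ≤
      ENNReal.ofReal (Real.exp ((Real.exp s - 1) * p * I.card)) := by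
    simp only [← hprod]
    rw [hind]
    refine (Finset.prod_le_prod' (g := fun _ =>
      ENNReal.ofReal (Real.exp ((Real.exp s - 1) * p))) fun i _ => ?_).trans ?_
    · rw [(measurePreserving_eval_sampleLaw P i).lintegral_comp hg]
      exact hgi
    · rw [Finset.prod_const, ← ENNReal.ofReal_pow (by positivity), ← Real.exp_nat_mul, mul_comm]
  have hmeas : Measurable fun ω : ℕ → X => ENNReal.ofReal (Real.exp (s * hitCount I D ω)) := by
    simp only [← hprod]
    exact Finset.measurable_prod _ fun i _ => hg.comp (measurable_pi_apply i)
  have hmarkov := mul_meas_ge_le_lintegral (μ := sampleLaw P) hmeas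
    (ENNReal.ofReal (Real.exp c))
  rw [Real.exp_sub, ENNReal.ofReal_div_of_pos (Real.exp_pos c), ENNReal.le_div_iff_mul_le
    (Or.inl (by simpa using Real.exp_pos c)) (Or.inl ENNReal.ofReal_ne_top), mul_comm]
  refine le_trans ?_ (hmarkov.trans hbound)
  gcongr with ω
  intro h
  exact ENNReal.ofReal_le_ofReal (Real.exp_le_exp.2 h)

/-- The Chernoff bound at s = log 2. For an upper tail `D` can be enlarged to its measurable hull,
which has the same measure. -/
theorem sampleLaw_le_hitCount_le (D : Set X) (I : Finset ℕ) (c : ℝ) :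
    sampleLaw P {ω | c ≤ hitCount I D ω} ≤
      ENNReal.ofReal (Real.exp ((P : Measure X).real D * I.card - Real.log 2 * c)) := by
  have h := sampleLaw_hitCount_le P (measurableSet_toMeasurable (P : Measure X) D) I (Real.log 2)
    (Real.log 2 * c)
  rw [Real.exp_log (by norm_num), measureReal_def, measure_toMeasurable, ← measureReal_def] at h
  refine (measure_mono fun ω hω => ?_).trans (h.trans (le_of_eq (by ring_nf)))
  have h2 : (hitCount I D ω : ℝ) ≤ hitCount I (toMeasurable (P : Measure X) D) ω := by
    exact_mod_cast hitCount_mono I (subset_toMeasurable _ _) ω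
  have h3 : c ≤ hitCount I D ω := hω
  exact mul_le_mul_of_nonneg_left (h3.trans h2) (Real.log_nonneg (by norm_num))

/-- The Chernoff bound at s = -log 2, where e^s - 1 = -1/2. A lower tail needs a measurable subset
of full measure in `D`, hence null-measurability. -/
theorem sampleLaw_hitCount_le_le {D : Set X} (hD : NullMeasurableSet D (P : Measure X))
    (I : Finset ℕ) (c : ℝ) :
    sampleLaw P {ω | (hitCount I D ω : ℝ) ≤ c} ≤
      ENNReal.ofReal (Real.exp (Real.log 2 * c - (P : Measure X).real D * I.card / 2)) := by
  obtain ⟨D', hD'D, hD', hD'e⟩ := hD.exists_measurable_subset_ae_eq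
  have h := sampleLaw_hitCount_le P hD' I (-Real.log 2) (-Real.log 2 * c)
  rw [Real.exp_neg, Real.exp_log (by norm_num), measureReal_congr hD'e] at h
  refine (measure_mono fun ω hω => ?_).trans (h.trans (le_of_eq (by ring_nf)))
  have h2 : (hitCount I D' ω : ℝ) ≤ hitCount I D ω := by
    exact_mod_cast hitCount_mono I hD'D ω
  have h3 : (hitCount I D ω : ℝ) ≤ c := hω
  have := mul_le_mul_of_nonneg_left (h2.trans h3) (Real.log_nonneg (x := 2) (by norm_num))
  simp only [Set.mem_ofPred_eq]
  linarith

end SampleLaw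

/-! ### Version spaces and regions of disagreement of a random sample. -/

section VersionSpace

variable {X : Type u} [MeasurableSpace X]

/-- The classifiers in `C` that agree with `f` on the first `a` examples. -/
def sampleVersionSpace (C : Set (Classifier X)) (f : Classifier X) (a : ℕ) (ω : ℕ → X) :
    Set (Classifier X) :=
  {h | h ∈ C ∧ ∀ i < a, h.1 (ω i) = f.1 (ω i)}

/-- The region of disagreement of the version space of the first `a` examples. -/
def sampleDisagreement (C : Set (Classifier X)) (f : Classifier X) (a : ℕ) (ω : ℕ → X) : Set X :=
  disagreementRegion (sampleVersionSpace C f a ω)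

variable {C : Set (Classifier X)} {f : Classifier X}

theorem self_mem_sampleVersionSpace (hf : f ∈ C) (a : ℕ) (ω : ℕ → X) :
    f ∈ sampleVersionSpace C f a ω :=
  ⟨hf, fun _ _ => rfl⟩

theorem mem_disagreementRegion_iff {H : Set (Classifier X)} (hf : f ∈ H) {x : X} :
    x ∈ disagreementRegion H ↔ ∃ h ∈ H, h.1 x ≠ f.1 x := by
  constructor
  · rintro ⟨h₁, hh₁, h₂, hh₂, hne⟩
    by_cases h : h₁.1 x = f.1 x
    · exact ⟨h₂, hh₂, fun h' => hne (h.trans h'.symm)⟩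
    · exact ⟨h₁, hh₁, h⟩
  · rintro ⟨h, hh, hne⟩
    exact ⟨h, hh, f, hf, hne⟩

theorem mem_sampleDisagreement_iff (hf : f ∈ C) {a : ℕ} {ω : ℕ → X} {x : X} :
    x ∈ sampleDisagreement C f a ω ↔
      ∃ h ∈ C, (∀ i < a, h.1 (ω i) = f.1 (ω i)) ∧ h.1 x ≠ f.1 x := by
  rw [sampleDisagreement, mem_disagreementRegion_iff (self_mem_sampleVersionSpace hf a ω)]
  simp [sampleVersionSpace, and_assoc]

theorem sampleVersionSpace_congr {a : ℕ} {ω ω' : ℕ → X} (h : ∀ i < a, ω i = ω' i) :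
    sampleVersionSpace C f a ω = sampleVersionSpace C f a ω' := by
  ext g
  refine and_congr_right fun _ => forall₂_congr fun i hi => ?_
  rw [h i hi]

theorem sampleDisagreement_congr {a : ℕ} {ω ω' : ℕ → X} (h : ∀ i < a, ω i = ω' i) :
    sampleDisagreement C f a ω = sampleDisagreement C f a ω' := by
  rw [sampleDisagreement, sampleVersionSpace_congr h, sampleDisagreement]

theorem disagreementRegion_mono {H H' : Set (Classifier X)} (h : H ⊆ H') :
    disagreementRegion H ⊆ disagreementRegion H' := by
  rintro x ⟨h₁, hh₁, h₂, hh₂, hne⟩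
  exact ⟨h₁, h hh₁, h₂, h hh₂, hne⟩

theorem sampleVersionSpace_anti {a b : ℕ} (hab : a ≤ b) (ω : ℕ → X) :
    sampleVersionSpace C f b ω ⊆ sampleVersionSpace C f a ω :=
  fun _ h => ⟨h.1, fun i hi => h.2 i (hi.trans_le hab)⟩

/-! ### Measurability of traces -/

/-- An event asking for some `h ∈ C` with prescribed behaviour relative to `f` on finitely many
examples is a finite union, over pairs of label patterns, of a trace event and a measurable event
for `f`. All later measurability rests on this. -/
theorem HasMeasurableTraces.nullMeasurableSet_pattern (hmeas : HasMeasurableTraces C)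
    (f : Classifier X) (P : ProbabilityMeasure X) (k : ℕ)
    (Q : (Fin k → Bool) → (Fin k → Bool) → Prop) :
    NullMeasurableSet {ω : ℕ → X | ∃ h ∈ C, Q (fun i => h.1 (ω i)) (fun i => f.1 (ω i))}
      (sampleLaw P) := by
  have key : {ω : ℕ → X | ∃ h ∈ C, Q (fun i => h.1 (ω i)) (fun i => f.1 (ω i))} =
      ⋃ (y : Fin k → Bool) (z : Fin k → Bool) (_ : Q y z),
        ((fun (ω : ℕ → X) (i : Fin k) => ω i) ⁻¹' {S | ∃ h ∈ C, ∀ i, h.1 (S i) = y i}) ∩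
          {ω : ℕ → X | (fun i : Fin k => f.1 (ω i)) = z} := by
    ext ω
    simp only [Set.mem_ofPred_eq, Set.mem_iUnion, Set.mem_inter_iff, Set.mem_preimage, exists_prop]
    constructor
    · rintro ⟨h, hh, hQ⟩
      exact ⟨_, _, hQ, ⟨h, hh, fun i => rfl⟩, rfl⟩
    · rintro ⟨y, z, hQ, ⟨h, hh, hy⟩, rfl⟩
      refine ⟨h, hh, ?_⟩
      rwa [show (fun i : Fin k => h.1 (ω i)) = y from funext hy]
  rw [key]
  refine .iUnion fun y => .iUnion fun z => .iUnion fun _ => .inter ?_ ?_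
  · exact (hmeas k y P).preimage
      (measurePreserving_reindex_fin P (j := fun i : Fin k => (i : ℕ))
        Fin.val_injective).quasiMeasurePreserving
  · have : Measurable fun ω : ℕ → X => fun i : Fin k => f.1 (ω i) :=
      measurable_pi_lambda _ fun i => f.2.comp (measurable_pi_apply _)
    exact (this (measurableSet_singleton z)).nullMeasurableSet

theorem nullMeasurableSet_mem_sampleDisagreement (hmeas : HasMeasurableTraces C) (hf : f ∈ C)
    (P : ProbabilityMeasure X) {a i : ℕ} (hai : a ≤ i) :
    NullMeasurableSet {ω : ℕ → X | ω i ∈ sampleDisagreement C f a ω} (sampleLaw P) := by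
  have h := hmeas.nullMeasurableSet_pattern f P (i + 1)
    fun y z => (∀ l : Fin (i + 1), (l : ℕ) < a → y l = z l) ∧ y (Fin.last i) ≠ z (Fin.last i)
  convert h using 2
  ext ω
  rw [mem_sampleDisagreement_iff hf]
  refine exists_congr fun g => and_congr_right fun _ => and_congr ?_ Iff.rfl
  exact ⟨fun H l hl => H l hl, fun H l hl => H ⟨l, by omega⟩ hl⟩

theorem sampleDisagreement_update {a i : ℕ} (hai : a ≤ i) (ω : ℕ → X) (x : X) :
    sampleDisagreement C f a (Function.update ω i x) = sampleDisagreement C f a ω :=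
  sampleDisagreement_congr fun l hl => Function.update_of_ne (by omega) _ _

theorem nullMeasurableSet_sampleDisagreement (hmeas : HasMeasurableTraces C) (hf : f ∈ C)
    (P : ProbabilityMeasure X) (a : ℕ) :
    NullMeasurableSet {p : (ℕ → X) × X | p.2 ∈ sampleDisagreement C f a p.1}
      ((sampleLaw P).prod (P : Measure X)) := by
  have h := (nullMeasurableSet_mem_sampleDisagreement hmeas hf P le_rfl (a := a)).preimage
    (measurePreserving_update P a).quasiMeasurePreserving
  convert h using 1
  ext p
  simp [sampleDisagreement_update]

end VersionSpace

/-! ### Sauer's lemma for classifiers -/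

section Sauer

variable {X : Type u} [MeasurableSpace X] {C : Set (Classifier X)}

theorem IsVCClass.exists_card_le (hVC : IsVCClass C) :
    ∃ d : ℕ, ∀ (k : ℕ) (S : Fin k → X), Shatters C S → k ≤ d := by
  obtain ⟨d, hd⟩ := ENat.ne_top_iff_exists.1 (ne_of_lt hVC)
  refine ⟨d, fun k S hS => ?_⟩
  have : (k : ℕ∞) ≤ vcDim C := le_iSup₂_of_le k ⟨S, hS⟩ le_rfl
  rw [← hd] at this
  exact_mod_cast this

open Classical in
/-- The sets of indices labelled `true` by some classifier in `C`. -/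
noncomputable def traceFamily (C : Set (Classifier X)) {N : ℕ} (x : Fin N → X) :
    Finset (Finset (Fin N)) :=
  Finset.univ.filter fun A => ∃ h ∈ C, ∀ i, i ∈ A ↔ h.1 (x i) = true

-- Shattering by the trace family yields a sequence shattered by `C`, so the Sauer–Shelah lemma
-- applies; each binomial coefficient is bounded crudely by `(N + 1) ^ d`.
open Classical in
theorem card_traceFamily_le {d : ℕ} (hd : ∀ (k : ℕ) (S : Fin k → X), Shatters C S → k ≤ d)
    {N : ℕ} (x : Fin N → X) : (traceFamily C x).card ≤ (d + 1) * (N + 1) ^ d := by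
  have hvc : (traceFamily C x).vcDim ≤ d := by
    refine Finset.sup_le fun s hs => ?_
    rw [Finset.mem_shatterer] at hs
    refine hd s.card (x ∘ s.orderEmbOfFin rfl) fun y => ?_
    obtain ⟨A, hA, hAs⟩ := hs (t := (Finset.univ.filter fun i => y i = true).image
      (s.orderEmbOfFin rfl)) (by
        intro j hj
        obtain ⟨i, -, rfl⟩ := Finset.mem_image.1 hj
        exact s.orderEmbOfFin_mem rfl i)
    obtain ⟨h, hh, hhA⟩ := (Finset.mem_filter.1 hA).2
    refine ⟨h, hh, fun i => ?_⟩
    have h1 : s.orderEmbOfFin rfl i ∈ s ∩ A ↔ y i = true := by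
      rw [hAs]; simp
    rw [Finset.mem_inter, and_iff_right (s.orderEmbOfFin_mem rfl i), hhA] at h1
    exact Bool.eq_iff_iff.2 h1
  calc (traceFamily C x).card ≤ ((traceFamily C x).shatterer).card :=
        Finset.card_le_card_shatterer _
    _ ≤ ∑ k ∈ Finset.Iic (traceFamily C x).vcDim, (Fintype.card (Fin N)).choose k :=
        Finset.card_shatterer_le_sum_vcDim
    _ ≤ ∑ k ∈ Finset.Iic d, (Fintype.card (Fin N)).choose k :=
        Finset.sum_le_sum_of_subset (Finset.Iic_subset_Iic.2 hvc)
    _ ≤ ∑ _k ∈ Finset.Iic d, (N + 1) ^ d := by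
        refine Finset.sum_le_sum fun k hk => ?_
        rw [Fintype.card_fin]
        calc N.choose k ≤ N ^ k := Nat.choose_le_pow _ _
          _ ≤ (N + 1) ^ k := Nat.pow_le_pow_left (by omega) _
          _ ≤ (N + 1) ^ d := Nat.pow_le_pow_right (by omega) (Finset.mem_Iic.1 hk)
    _ = (d + 1) * (N + 1) ^ d := by simp

end Sauer

/-! ### Uniform consistency of the version space -/

section Symmetrization

variable {X : Type u} [MeasurableSpace X] {C : Set (Classifier X)} {f : Classifier X}

/-- Swap `i` and `m + i` for those `i < m` with `τ i = true`. -/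
def swapIndex (m : ℕ) (τ : Fin m → Bool) (i : ℕ) : ℕ :=
  if h : i < m then (if τ ⟨i, h⟩ then i + m else i)
  else if h' : i - m < m then (if τ ⟨i - m, h'⟩ then i - m else i) else i

theorem swapIndex_involutive (m : ℕ) (τ : Fin m → Bool) :
    Function.Involutive (swapIndex m τ) := by
  intro i
  unfold swapIndex
  by_cases h : i < m
  · by_cases ht : τ ⟨i, h⟩ = true
    · simp [h, ht]
    · simp [h, ht]
  · by_cases h' : i - m < m
    · by_cases ht : τ ⟨i - m, h'⟩ = true
      · simp [h, h', ht]; omega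
      · simp [h, h', ht]
    · simp [h, h']

/-- Read `B` as the set of error positions. If a swap clears the first half, it is forced on each
pair containing an error: it must move that error into the second half. More than `t` errors there
require more than `t` such pairs, leaving at most 2^(m-t) swaps. -/
theorem card_swaps_le (m : ℕ) (B : ℕ → Prop) (t : ℝ) [DecidablePred B]
    [DecidablePred fun τ : Fin m → Bool => (∀ i < m, ¬ B (swapIndex m τ i)) ∧
      t < ((Finset.Ico m (2 * m)).filter fun i => B (swapIndex m τ i)).card] :
    ((Finset.univ.filter fun τ : Fin m → Bool => (∀ i < m, ¬ B (swapIndex m τ i)) ∧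
      t < ((Finset.Ico m (2 * m)).filter fun i => B (swapIndex m τ i)).card).card : ℝ) ≤
      2 ^ m * (2 : ℝ) ^ (-t) := by
  classical
  set I : Finset (Fin m) := Finset.univ.filter fun i => B i ∨ B (i + m) with hI
  -- A single admissible swap already shows `t < I.card`; if there is none, the count is zero.
  by_cases hne : ∃ τ : Fin m → Bool, (∀ i < m, ¬ B (swapIndex m τ i)) ∧
      t < ((Finset.Ico m (2 * m)).filter fun i => B (swapIndex m τ i)).card
  · obtain ⟨τ₀, -, hτ₀⟩ := hne
    have hcardI : t < I.card := by
      refine hτ₀.trans_le ?_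
      have : ((Finset.Ico m (2 * m)).filter fun i => B (swapIndex m τ₀ i)) ⊆
          I.image fun i : Fin m => (i : ℕ) + m := by
        intro i hi
        rw [Finset.mem_filter, Finset.mem_Ico] at hi
        obtain ⟨⟨h1, h2⟩, h3⟩ := hi
        have h4 : ¬ i < m := by omega
        have h5 : i - m < m := by omega
        refine Finset.mem_image.2 ⟨⟨i - m, h5⟩, ?_, by simp; omega⟩
        rw [hI, Finset.mem_filter]
        refine ⟨Finset.mem_univ _, ?_⟩
        simp only [swapIndex, h4, h5, dif_neg, dif_pos, not_false_eq_true] at h3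
        split_ifs at h3
        · exact Or.inl h3
        · right
          simpa [Nat.sub_add_cancel h1] using h3
      exact_mod_cast (Finset.card_le_card this).trans Finset.card_image_le
    have hsub : (Finset.univ.filter fun τ : Fin m → Bool => (∀ i < m, ¬ B (swapIndex m τ i)) ∧
        t < ((Finset.Ico m (2 * m)).filter fun i => B (swapIndex m τ i)).card) ⊆
        Fintype.piFinset fun i : Fin m => if i ∈ I then {decide (B i)} else Finset.univ := by
      intro τ hτ
      have hτ' := (Finset.mem_filter.1 hτ).2.1
      refine Fintype.mem_piFinset.2 fun i => ?_
      by_cases hi : i ∈ I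
      · have h1 := hτ' i i.2
        rw [hI, Finset.mem_filter] at hi
        simp only [swapIndex, i.2, dif_pos, Fin.eta] at h1
        by_cases ht : τ i = true
        · have hB : B i := by
            rcases hi.2 with h | h
            · exact h
            · simp [ht] at h1; exact absurd h h1
          have : i ∈ I := by rw [hI, Finset.mem_filter]; exact hi
          simp [this, ht, hB]
        · have hB : ¬ B i := by simpa [ht] using h1
          have : i ∈ I := by rw [hI, Finset.mem_filter]; exact hi
          simp [this, ht, hB]
      · simp [hi]
    have hcard := Finset.card_le_card hsub
    rw [Fintype.card_piFinset] at hcard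
    have hprod : (∏ i : Fin m, (if i ∈ I then ({decide (B i)} : Finset Bool)
        else Finset.univ).card) = 2 ^ (m - I.card) := by
      have : ∀ i : Fin m, (if i ∈ I then ({decide (B i)} : Finset Bool)
          else Finset.univ).card = if i ∈ I then 1 else 2 := by
        intro i; split_ifs <;> simp
      simp only [this]
      rw [Finset.prod_ite, Finset.prod_const_one, one_mul, Finset.prod_const]
      congr 1
      rw [Finset.filter_not, Finset.card_sdiff_of_subset (Finset.filter_subset _ _)]
      simp
    rw [hprod] at hcard
    have hIm : I.card ≤ m := by simpa using Finset.card_le_univ I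
    calc _ ≤ ((2 ^ (m - I.card) : ℕ) : ℝ) := by exact_mod_cast hcard
      _ = (2 : ℝ) ^ ((m : ℝ) - I.card) := by
        rw [← Nat.cast_sub hIm, Real.rpow_natCast]; push_cast; rfl
      _ ≤ (2 : ℝ) ^ ((m : ℝ) - t) := Real.rpow_le_rpow_of_exponent_le (by norm_num) (by linarith)
      _ = 2 ^ m * (2 : ℝ) ^ (-t) := by
        rw [sub_eq_add_neg, Real.rpow_add (by norm_num), Real.rpow_natCast]
  · rw [Finset.filter_false_of_mem fun τ _ h => hne ⟨τ, h⟩]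
    simp only [Finset.card_empty, Nat.cast_zero]
    positivity

open Classical in
/-- Some classifier in `C` agrees with `f` on the first `m` examples and has more than `t` errors
on the next `m`. -/
def doubleSampleEvent (C : Set (Classifier X)) (f : Classifier X) (m : ℕ) (t : ℝ) :
    Set (ℕ → X) :=
  {ω | ∃ h ∈ C, (∀ i < m, ¬ h.1 (ω i) ≠ f.1 (ω i)) ∧
    t < ((Finset.Ico m (2 * m)).filter fun i => h.1 (ω i) ≠ f.1 (ω i)).card}

theorem nullMeasurableSet_doubleSampleEvent (hmeas : HasMeasurableTraces C) (f : Classifier X)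
    (P : ProbabilityMeasure X) (m : ℕ) (t : ℝ) :
    NullMeasurableSet (doubleSampleEvent C f m t) (sampleLaw P) := by
  classical
  have h := hmeas.nullMeasurableSet_pattern f P (2 * m) fun y z =>
    (∀ i : Fin (2 * m), (i : ℕ) < m → ¬ y i ≠ z i) ∧
      t < ((Finset.univ : Finset (Fin (2 * m))).filter
        fun i : Fin (2 * m) => m ≤ (i : ℕ) ∧ y i ≠ z i).card
  convert h using 2
  ext ω
  refine exists_congr fun g => and_congr_right fun _ => and_congr ?_ ?_
  · exact ⟨fun H l hl => H l hl, fun H l hl => H ⟨l, by omega⟩ hl⟩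
  · rw [← Finset.card_map Fin.valEmbedding]
    refine iff_of_eq (congrArg _ (congrArg _ (congrArg _ ?_)))
    ext i
    simp only [Finset.mem_filter, Finset.mem_Ico, Finset.mem_map, Finset.mem_univ, true_and,
      Fin.valEmbedding_apply]
    constructor
    · rintro ⟨⟨h1, h2⟩, h3⟩
      exact ⟨⟨i, h2⟩, ⟨h1, h3⟩, rfl⟩
    · rintro ⟨j, ⟨h1, h2⟩, rfl⟩
      exact ⟨⟨h1, j.2⟩, h2⟩

/-- Each of the 2^m swaps preserves the law, so the probability is an average over swaps. For fixed
`ω` only the traces of `C` on 2m points matter: `card_traceFamily_le` counts them and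
`card_swaps_le` bounds the swaps admissible for each. -/
theorem sampleLaw_doubleSampleEvent_le (hmeas : HasMeasurableTraces C) {d : ℕ}
    (hd : ∀ (k : ℕ) (S : Fin k → X), Shatters C S → k ≤ d) (f : Classifier X)
    (P : ProbabilityMeasure X) (m : ℕ) (t : ℝ) :
    sampleLaw P (doubleSampleEvent C f m t) ≤
      ENNReal.ofReal ((d + 1) * (2 * m + 1) ^ d * (2 : ℝ) ^ (-t)) := by
  classical
  set E := doubleSampleEvent C f m t with hE
  have hEm := nullMeasurableSet_doubleSampleEvent hmeas f P m t
  let π : (Fin m → Bool) → (ℕ → X) → (ℕ → X) := fun τ ω i => ω (swapIndex m τ i)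
  have hπ : ∀ τ, MeasurePreserving (π τ) (sampleLaw P) (sampleLaw P) := fun τ =>
    measurePreserving_reindex P (swapIndex_involutive m τ).injective
  have hcount : ∀ ω : ℕ → X,
      ((Finset.univ.filter fun τ : Fin m → Bool => π τ ω ∈ E).card : ℝ) ≤
        (d + 1) * (2 * m + 1) ^ d * (2 ^ m * (2 : ℝ) ^ (-t)) := by
    intro ω
    let x : Fin (2 * m) → X := fun i => ω i
    -- The positions among the first `2 * m` where the labelling given by `A` differs from `f`.
    let B : Finset (Fin (2 * m)) → ℕ → Prop := fun A i =>
      ∃ h : i < 2 * m, ¬ ((⟨i, h⟩ : Fin (2 * m)) ∈ A ↔ f.1 (ω i) = true)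
    have hsub : (Finset.univ.filter fun τ : Fin m → Bool => π τ ω ∈ E) ⊆
        (traceFamily C x).biUnion fun A => Finset.univ.filter fun τ : Fin m → Bool =>
          (∀ i < m, ¬ B A (swapIndex m τ i)) ∧
            t < ((Finset.Ico m (2 * m)).filter fun i => B A (swapIndex m τ i)).card := by
      intro τ hτ
      obtain ⟨h, hh, h1, h2⟩ := (Finset.mem_filter.1 hτ).2
      rw [Finset.mem_biUnion]
      refine ⟨Finset.univ.filter fun i => h.1 (x i) = true, ?_, ?_⟩
      · exact Finset.mem_filter.2 ⟨Finset.mem_univ _, h, hh, by simp⟩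
      · have hB : ∀ i < 2 * m, (B (Finset.univ.filter fun i => h.1 (x i) = true)
            (swapIndex m τ i) ↔ h.1 (π τ ω i) ≠ f.1 (π τ ω i)) := by
          intro i hi
          have hlt : swapIndex m τ i < 2 * m := by
            unfold swapIndex
            split_ifs <;> omega
          simp only [B, hlt, exists_true_left, Finset.mem_filter, Finset.mem_univ, true_and, x, π,
            ← Bool.eq_iff_iff, ne_eq]
        refine Finset.mem_filter.2 ⟨Finset.mem_univ _, fun i hi => ?_, ?_⟩
        · rw [hB i (by omega)]
          exact h1 i hi
        · refine h2.trans_le (le_of_eq ?_)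
          congr 2
          refine Finset.filter_congr fun i hi => ?_
          exact (hB i (Finset.mem_Ico.1 hi).2).symm
    calc ((Finset.univ.filter fun τ : Fin m → Bool => π τ ω ∈ E).card : ℝ)
        ≤ ∑ A ∈ traceFamily C x, ((Finset.univ.filter fun τ : Fin m → Bool =>
          (∀ i < m, ¬ B A (swapIndex m τ i)) ∧
            t < ((Finset.Ico m (2 * m)).filter fun i => B A (swapIndex m τ i)).card).card : ℝ) := by
          exact_mod_cast (Finset.card_le_card hsub).trans Finset.card_biUnion_le
      _ ≤ ∑ _A ∈ traceFamily C x, (2 ^ m * (2 : ℝ) ^ (-t)) :=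
          Finset.sum_le_sum fun A _ => card_swaps_le m (B A) t
      _ = (traceFamily C x).card * (2 ^ m * (2 : ℝ) ^ (-t)) := by simp
      _ ≤ _ := by
          refine mul_le_mul_of_nonneg_right ?_ (by positivity)
          exact_mod_cast card_traceFamily_le hd x
  have hsum : ∑ τ : Fin m → Bool, sampleLaw P E =
      ∫⁻ ω, ∑ τ : Fin m → Bool, (π τ ⁻¹' E).indicator 1 ω ∂(sampleLaw P) := by
    rw [lintegral_finsetSum']
    · refine Finset.sum_congr rfl fun τ _ => ?_
      rw [lintegral_indicator_one₀ (hEm.preimage (hπ τ).quasiMeasurePreserving),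
        (hπ τ).measure_preimage hEm]
    · intro τ _
      exact aemeasurable_const.indicator₀ (hEm.preimage (hπ τ).quasiMeasurePreserving)
  have hle : ∫⁻ ω, ∑ τ : Fin m → Bool, (π τ ⁻¹' E).indicator 1 ω ∂(sampleLaw P) ≤
      ENNReal.ofReal ((d + 1) * (2 * m + 1) ^ d * (2 ^ m * (2 : ℝ) ^ (-t))) := by
    refine (lintegral_mono (g := fun _ =>
      ENNReal.ofReal ((d + 1) * (2 * m + 1) ^ d * (2 ^ m * (2 : ℝ) ^ (-t)))) fun ω => ?_).trans
        (by simp)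
    have : ∑ τ : Fin m → Bool, (π τ ⁻¹' E).indicator (1 : (ℕ → X) → ℝ≥0∞) ω =
        ((Finset.univ.filter fun τ : Fin m → Bool => π τ ω ∈ E).card : ℝ≥0∞) := by
      simp [Set.indicator_apply]
    rw [this, ← ENNReal.ofReal_natCast]
    exact ENNReal.ofReal_le_ofReal (hcount ω)
  rw [← hsum] at hle
  simp only [Finset.sum_const, Finset.card_univ, Fintype.card_pi, Fintype.card_bool,
    Finset.prod_const, Fintype.card_fin, nsmul_eq_mul] at hle
  rw [show ((d : ℝ) + 1) * (2 * m + 1) ^ d * (2 ^ m * (2 : ℝ) ^ (-t)) =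
    2 ^ m * ((d + 1) * (2 * m + 1) ^ d * (2 : ℝ) ^ (-t)) by ring,
    ENNReal.ofReal_mul (by positivity)] at hle
  have h2 : ENNReal.ofReal ((2 : ℝ) ^ m) = ((2 ^ m : ℕ) : ℝ≥0∞) := by
    rw [← ENNReal.ofReal_natCast]; push_cast; rfl
  rw [h2] at hle
  exact (ENNReal.mul_le_mul_iff_right (by simp) (by simp)).1 hle

end Symmetrization

/-! ### From uniform deviations to exponentially rare large disagreement. -/

section Consistency

variable {X : Type u} [MeasurableSpace X] {C : Set (Classifier X)} {f : Classifier X}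

/-- Some classifier in the version space of the first `m` examples has error rate above `r`. -/
def inaccurateEvent (C : Set (Classifier X)) (f : Classifier X) (P : ProbabilityMeasure X) (r : ℝ)
    (m : ℕ) : Set (ℕ → X) :=
  {ω | ∃ h ∈ sampleVersionSpace C f m ω, ENNReal.ofReal r < errorRate P f h}

theorem half_le_measure_many_errors (P : ProbabilityMeasure X) {r : ℝ} {m : ℕ}
    (hm : Real.exp (-((1 - Real.log 2) * r / 2) * m) ≤ 1 / 2) (I : Finset ℕ) (hI : I.card = m)
    {h : Classifier X} (hr : ENNReal.ofReal r < errorRate P f h) :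
    1 / 2 ≤ sampleLaw P {ω | r * m / 2 < hitCount I {x | h.1 x ≠ f.1 x} ω} := by
  set D := {x | h.1 x ≠ f.1 x} with hD
  have hDm : MeasurableSet D := (measurableSet_eq_fun h.2 f.2).compl
  have hp : r ≤ (P : Measure X).real D := by
    by_contra hlt
    push Not at hlt
    refine absurd hr (not_lt.2 ?_)
    rw [errorRate, ← hD, ← ofReal_measureReal (measure_ne_top _ _)]
    exact ENNReal.ofReal_le_ofReal hlt.le
  have h1 := sampleLaw_hitCount_le_le P hDm.nullMeasurableSet I (r * m / 2)
  have h2 : sampleLaw P {ω | (hitCount I D ω : ℝ) ≤ r * m / 2} ≤ 1 / 2 := by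
    refine h1.trans ?_
    rw [show (1 / 2 : ℝ≥0∞) = ENNReal.ofReal (1 / 2) by
      rw [ENNReal.ofReal_div_of_pos (by norm_num)]; simp]
    refine ENNReal.ofReal_le_ofReal (le_trans (Real.exp_le_exp.2 ?_) hm)
    rw [hI]
    have := mul_le_mul_of_nonneg_right hp (Nat.cast_nonneg (α := ℝ) m)
    linarith
  have h3 : (1 : ℝ≥0∞) ≤ sampleLaw P {ω | r * m / 2 < hitCount I D ω} + 1 / 2 := by
    calc (1 : ℝ≥0∞) = sampleLaw P Set.univ := measure_univ.symm
      _ ≤ sampleLaw P ({ω | r * m / 2 < hitCount I D ω} ∪ {ω | (hitCount I D ω : ℝ) ≤ r * m / 2}) :=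
        measure_mono fun ω _ => lt_or_ge (r * m / 2) (hitCount I D ω : ℝ)
      _ ≤ _ := (measure_union_le _ _).trans (by gcongr)
  exact (ENNReal.add_le_add_iff_right (show (1 / 2 : ℝ≥0∞) ≠ ⊤ by simp)).1
    ((ENNReal.add_halves 1).le.trans h3)

/-- Ghost sample: an inaccurate `h` chosen from the first `m` examples errs on more than rm/2 of `m`
independent further examples with probability at least 1/2, so the inaccurate event has at most
twice the probability of the double-sample event. -/
theorem sampleLaw_inaccurateEvent_le (hmeas : HasMeasurableTraces C) {d : ℕ}
    (hd : ∀ (k : ℕ) (S : Fin k → X), Shatters C S → k ≤ d) (f : Classifier X)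
    (P : ProbabilityMeasure X) {r : ℝ} {m : ℕ}
    (hm : Real.exp (-((1 - Real.log 2) * r / 2) * m) ≤ 1 / 2) :
    sampleLaw P (inaccurateEvent C f P r m) ≤
      2 * ENNReal.ofReal ((d + 1) * (2 * m + 1) ^ d * (2 : ℝ) ^ (-(r * m / 2))) := by
  classical
  set E := doubleSampleEvent C f m (r * m / 2) with hE
  have hEm := nullMeasurableSet_doubleSampleEvent hmeas f P m (r * m / 2)
  have hJ := measurePreserving_mergeSeq P {i | i < m}
  have hF := hEm.preimage hJ.quasiMeasurePreserving
  have h1 := mul_meas_ge_le_lintegral₀ hF.aemeasurable_measure_prodMk_left (1 / 2)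
  rw [← hF.prod_apply, hJ.measure_preimage hEm] at h1
  -- The inaccurate event need not be measurable; it is enclosed in a superlevel set of the section
  -- measures, to which Markov's inequality applies.
  have h2 : sampleLaw P (inaccurateEvent C f P r m) ≤ sampleLaw P
      {ω | 1 / 2 ≤ sampleLaw P (Prod.mk ω ⁻¹' (mergeSeq {i | i < m} ⁻¹' E))} := by
    refine measure_mono fun ω hω => ?_
    obtain ⟨h, hh, hr⟩ := hω
    refine (half_le_measure_many_errors P hm (Finset.Ico m (2 * m)) (by simp; omega) hr).trans
      (measure_mono fun ω' hω' => ?_)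
    refine ⟨h, hh.1, fun i hi => ?_, ?_⟩
    · simpa [mergeSeq, hi] using hh.2 i hi
    · refine lt_of_lt_of_le (b := (hitCount (Finset.Ico m (2 * m)) {x | h.1 x ≠ f.1 x} ω' : ℝ))
        hω' (le_of_eq ?_)
      unfold hitCount
      congr 2
      ext i
      simp only [Finset.mem_filter]
      refine and_congr_right fun hi => ?_
      have : ¬ i < m := by have := (Finset.mem_Ico.1 hi).1; omega
      simp [mergeSeq, this]
  have h3 := h1.trans (sampleLaw_doubleSampleEvent_le hmeas hd f P m (r * m / 2))
  calc _ = 2 * (1 / 2 * sampleLaw P (inaccurateEvent C f P r m)) := by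
        rw [← mul_assoc, one_div, ENNReal.mul_inv_cancel (by simp) (by simp), one_mul]
    _ ≤ _ := by gcongr; exact (mul_le_mul_right h2 _).trans h3

theorem tendsto_growth_mul_rpow (d : ℕ) {r : ℝ} (hr : 0 < r) :
    Tendsto (fun m : ℕ => ((d : ℝ) + 1) * (2 * m + 1) ^ d * (2 : ℝ) ^ (-(r * m / 2))) atTop
      (𝓝 0) := by
  have hb : |(2 : ℝ) ^ (-(r / 2))| < 1 := by
    rw [abs_of_pos (by positivity)]
    exact Real.rpow_lt_one_of_one_lt_of_neg (by norm_num) (by linarith)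
  have h := (tendsto_pow_const_mul_const_pow_of_abs_lt_one d hb).const_mul
    (((d : ℝ) + 1) * 3 ^ d)
  rw [mul_zero] at h
  refine squeeze_zero' (Eventually.of_forall fun m => by positivity) ?_ h
  filter_upwards [eventually_ge_atTop 1] with m hm
  have h1 : (2 : ℝ) ^ (-(r * m / 2)) = ((2 : ℝ) ^ (-(r / 2))) ^ m := by
    rw [← Real.rpow_natCast, ← Real.rpow_mul (by norm_num)]
    congr 1; ring
  have hm' : (1 : ℝ) ≤ m := by exact_mod_cast hm
  have h2 : (2 * (m : ℝ) + 1) ^ d ≤ 3 ^ d * m ^ d := by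
    rw [← mul_pow]
    exact pow_le_pow_left₀ (by positivity) (by linarith) d
  rw [h1]
  calc ((d : ℝ) + 1) * (2 * m + 1) ^ d * ((2 : ℝ) ^ (-(r / 2))) ^ m
      ≤ ((d : ℝ) + 1) * (3 ^ d * m ^ d) * ((2 : ℝ) ^ (-(r / 2))) ^ m := by gcongr
    _ = _ := by ring

theorem sampleLaw_iInter_inaccurateEvent (hVC : IsVCClass C) (hmeas : HasMeasurableTraces C)
    (f : Classifier X) (P : ProbabilityMeasure X) {r : ℝ} (hr : 0 < r) :
    sampleLaw P (⋂ m, inaccurateEvent C f P r m) = 0 := by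
  obtain ⟨d, hd⟩ := hVC.exists_card_le
  have h1 := ENNReal.Tendsto.const_mul (ENNReal.tendsto_ofReal (tendsto_growth_mul_rpow d hr))
    (Or.inr (ENNReal.ofNat_ne_top (n := 2)))
  rw [ENNReal.ofReal_zero, mul_zero] at h1
  refine le_antisymm (ge_of_tendsto h1 ?_) zero_le
  have hlog : Real.log 2 < 1 := Real.log_two_lt_d9.trans (by norm_num)
  have h2 : Tendsto (fun m : ℕ => Real.exp (-((1 - Real.log 2) * r / 2) * m)) atTop (𝓝 0) := by
    refine Real.tendsto_exp_atBot.comp (Tendsto.const_mul_atTop_of_neg ?_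
      tendsto_natCast_atTop_atTop)
    have := mul_pos (sub_pos.2 hlog) hr
    linarith
  filter_upwards [h2.eventually_le_const (show (0 : ℝ) < 1 / 2 by norm_num)] with m hm
  exact (measure_mono (Set.iInter_subset _ m)).trans
    (sampleLaw_inaccurateEvent_le hmeas hd f P hm)

/-- If the disagreement core is null, then so is the limit of the regions of disagreement. -/
theorem tendsto_prod_sampleDisagreement (hVC : IsVCClass C) (hmeas : HasMeasurableTraces C)
    (hf : f ∈ C) (P : ProbabilityMeasure X) (hcore : (P : Measure X) (disagreementCore C P f) = 0) :
    Tendsto (fun a => ((sampleLaw P).prod (P : Measure X))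
      {p | p.2 ∈ sampleDisagreement C f a p.1}) atTop (𝓝 0) := by
  have h := tendsto_measure_iInter_atTop (μ := (sampleLaw P).prod (P : Measure X))
    (fun a => nullMeasurableSet_sampleDisagreement hmeas hf P a)
    (fun a b hab p hp => disagreementRegion_mono (sampleVersionSpace_anti hab p.1) hp)
    ⟨0, measure_ne_top _ _⟩
  have h0 : ((sampleLaw P).prod (P : Measure X))
      (⋂ a, {p | p.2 ∈ sampleDisagreement C f a p.1}) = 0 := by
    have hBad : sampleLaw P (⋃ k : ℕ, ⋂ m, inaccurateEvent C f P (1 / ((k : ℝ) + 1)) m) = 0 :=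
      measure_iUnion_null fun k =>
        sampleLaw_iInter_inaccurateEvent hVC hmeas f P (by positivity)
    -- Off the first null set, each ball about `f` contains some version space, so a point lying in
    -- every region of disagreement lies in the core.
    refine measure_mono_null (t := ((⋃ k : ℕ, ⋂ m, inaccurateEvent C f P (1 / ((k : ℝ) + 1)) m) ×ˢ
      Set.univ) ∪ (Set.univ ×ˢ disagreementCore C P f)) ?_ (measure_union_null ?_ ?_)
    · rintro ⟨ω, x⟩ hp
      by_cases hω : ω ∈ ⋃ k : ℕ, ⋂ m, inaccurateEvent C f P (1 / ((k : ℝ) + 1)) m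
      · exact Or.inl ⟨hω, trivial⟩
      refine Or.inr ⟨trivial, Set.mem_iInter₂.2 fun r hr => ?_⟩
      obtain ⟨k, hk⟩ := exists_nat_one_div_lt hr
      simp only [Set.mem_iUnion, Set.mem_iInter, not_exists, not_forall] at hω
      obtain ⟨m, hm⟩ := hω k
      have hsub : sampleVersionSpace C f m ω ⊆ classifierBall C P f r := by
        intro h hh
        refine ⟨hh.1, ?_⟩
        by_contra hlt
        exact hm ⟨h, hh, (ENNReal.ofReal_le_ofReal hk.le).trans_lt (not_le.1 hlt)⟩
      exact disagreementRegion_mono hsub (Set.mem_iInter.1 hp m)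
    · rw [Measure.prod_prod, hBad, zero_mul]
    · rw [Measure.prod_prod, hcore, mul_zero]
  rw [h0] at h
  exact h

/-- The event that the region of disagreement has probability more than `η`. -/
def largeDisagreementEvent (C : Set (Classifier X)) (f : Classifier X) (P : ProbabilityMeasure X)
    (η : ℝ≥0∞) (a : ℕ) : Set (ℕ → X) :=
  {ω | η < (P : Measure X) (sampleDisagreement C f a ω)}

theorem aemeasurable_measure_sampleDisagreement (hmeas : HasMeasurableTraces C) (hf : f ∈ C)
    (P : ProbabilityMeasure X) (a : ℕ) :
    AEMeasurable (fun ω => (P : Measure X) (sampleDisagreement C f a ω)) (sampleLaw P) :=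
  (nullMeasurableSet_sampleDisagreement hmeas hf P a).aemeasurable_measure_prodMk_left

theorem nullMeasurableSet_largeDisagreementEvent (hmeas : HasMeasurableTraces C) (hf : f ∈ C)
    (P : ProbabilityMeasure X) (η : ℝ≥0∞) (a : ℕ) :
    NullMeasurableSet (largeDisagreementEvent C f P η a) (sampleLaw P) :=
  nullMeasurableSet_lt aemeasurable_const (aemeasurable_measure_sampleDisagreement hmeas hf P a)

/-- The version space of a long sample lies in the version space of each block of `m` examples, so
large disagreement must occur on all blocks, which are independent. -/
theorem sampleLaw_largeDisagreementEvent_mul_le (hmeas : HasMeasurableTraces C) (hf : f ∈ C)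
    (P : ProbabilityMeasure X) (η : ℝ≥0∞) (m j : ℕ) :
    sampleLaw P (largeDisagreementEvent C f P η (j * m)) ≤
      sampleLaw P (largeDisagreementEvent C f P η m) ^ j := by
  induction j with
  | zero => simpa using prob_le_one
  | succ j ih =>
    have hshift := measurePreserving_reindex P (j := fun i => j * m + i) (add_right_injective _)
    have hnm := nullMeasurableSet_largeDisagreementEvent hmeas hf P η
    have hsub : largeDisagreementEvent C f P η ((j + 1) * m) ⊆
        largeDisagreementEvent C f P η (j * m) ∩
          (fun (ω : ℕ → X) i => ω (j * m + i)) ⁻¹' largeDisagreementEvent C f P η m := by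
      have hle : j * m + m ≤ (j + 1) * m := by rw [add_mul, one_mul]
      intro ω hω
      have hsub : sampleVersionSpace C f ((j + 1) * m) ω ⊆
          sampleVersionSpace C f m fun i => ω (j * m + i) := fun h hh =>
        ⟨hh.1, fun i hi => hh.2 _ (by omega)⟩
      exact ⟨lt_of_lt_of_le hω (measure_mono (disagreementRegion_mono
        (sampleVersionSpace_anti (by omega) ω))), lt_of_lt_of_le hω (measure_mono
          (disagreementRegion_mono hsub))⟩
    refine (measure_mono hsub).trans ?_
    rw [sampleLaw_inter_of_disjoint P {i | i < j * m} (hnm _)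
      ((hnm m).preimage hshift.quasiMeasurePreserving), hshift.measure_preimage (hnm m), pow_succ]
    · gcongr
    · intro ω ω' h
      simp only [largeDisagreementEvent, Set.mem_ofPred_eq]
      rw [sampleDisagreement_congr h]
    · intro ω ω' h
      simp only [largeDisagreementEvent, Set.mem_ofPred_eq, Set.mem_preimage]
      rw [sampleDisagreement_congr fun i _ => h (j * m + i) (by simp)]

/-- The region of disagreement is small up to an exponentially small probability. -/
theorem exists_sampleLaw_largeDisagreementEvent_le (hVC : IsVCClass C)
    (hmeas : HasMeasurableTraces C) (hf : f ∈ C) (P : ProbabilityMeasure X)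
    (hcore : (P : Measure X) (disagreementCore C P f) = 0) {η : ℝ≥0∞} (hη : η ≠ 0)
    (hη' : η ≠ ⊤) :
    ∃ m : ℕ, 0 < m ∧ ∀ a, sampleLaw P (largeDisagreementEvent C f P η a) ≤ (1 / 2) ^ (a / m) := by
  have h := tendsto_prod_sampleDisagreement hVC hmeas hf P hcore
  obtain ⟨m, hm, hm0⟩ := ((h.eventually_le_const (u := η * (1 / 2)) (by
    refine ENNReal.mul_pos hη (by simp))).and (eventually_gt_atTop 0)).exists
  refine ⟨m, hm0, fun a => ?_⟩
  -- Markov's inequality, as `m` was chosen to make the mean disagreement at most η/2.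
  have hhalf : sampleLaw P (largeDisagreementEvent C f P η m) ≤ 1 / 2 := by
    have h1 := mul_meas_ge_le_lintegral₀ (aemeasurable_measure_sampleDisagreement hmeas hf P m) η
    rw [(nullMeasurableSet_sampleDisagreement hmeas hf P m).prod_apply] at hm
    have h2 : η * sampleLaw P (largeDisagreementEvent C f P η m) ≤ η * (1 / 2) := by
      refine le_trans (mul_le_mul_right (measure_mono fun ω hω => ?_) _) (h1.trans hm)
      exact (show η < _ from hω).le
    exact (ENNReal.mul_le_mul_iff_right hη hη').1 h2
  calc sampleLaw P (largeDisagreementEvent C f P η a)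
      ≤ sampleLaw P (largeDisagreementEvent C f P η (a / m * m)) := measure_mono fun ω hω =>
        lt_of_lt_of_le hω (measure_mono (disagreementRegion_mono
          (sampleVersionSpace_anti (Nat.div_mul_le_self a m) ω)))
    _ ≤ _ := sampleLaw_largeDisagreementEvent_mul_le hmeas hf P η m (a / m)
    _ ≤ _ := by gcongr

end Consistency

/-! ### The sample constructed by the meta-algorithm -/

theorem LabelProtocol.run_bind {α β : Type u} (y : ℕ → Bool) (p : LabelProtocol α)
    (k : α → LabelProtocol β) : (p.bind k).run y = (k (p.run y)).run y := by
  induction p with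
  | done a => rfl
  | ask i next ih => exact ih (y i)

theorem run_requestFirst {X : Type u} (x : ℕ → X) (y : ℕ → Bool) (k : ℕ) :
    (requestFirst x k).run y = List.ofFn fun i : Fin k => (x i, y i) := by
  induction k with
  | zero => simp [requestFirst, LabelProtocol.run]
  | succ k ih =>
    rw [requestFirst, LabelProtocol.run_bind, ih, List.ofFn_succ_last]
    rfl

section Sample

variable {X : Type u} [MeasurableSpace X] {C : Set (Classifier X)} {f : Classifier X}

theorem versionSpace_ofFn (C : Set (Classifier X)) (f : Classifier X) (a : ℕ) (ω : ℕ → X) :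
    versionSpace C (List.ofFn fun i : Fin a => (ω i, f.1 (ω i))) = sampleVersionSpace C f a ω := by
  ext h
  refine and_congr_right fun _ => ?_
  rw [empiricalError, div_eq_zero_iff]
  simp only [Nat.cast_eq_zero, List.countP_eq_zero, List.length_ofFn, List.forall_mem_ofFn_iff,
    bne_iff_ne, ne_eq, not_not]
  -- Division by the length 0 makes the empirical error vanish on the empty sample; that case is `a
  -- = 0`, where the condition is empty.
  constructor
  · rintro (H | rfl) i hi
    · exact H ⟨i, hi⟩
    · omega
  · exact fun H => Or.inl fun i => H i i.2

theorem length_run_secondBatch (n : ℕ) (x : ℕ → X) (D : Set X)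
    (infer : ℕ → List (X × Bool) → Classifier X) (y : ℕ → Bool) (K m t : ℕ)
    (L : List (X × Bool)) :
    ((secondBatch n x D infer K m t L).run y).length = L.length + K := by
  induction K generalizing m t L with
  | zero => simp [secondBatch, LabelProtocol.run]
  | succ K ih =>
    rw [secondBatch]
    split_ifs with h
    · rw [LabelProtocol.run, ih]; simp; omega
    · rw [ih]; simp; omega

omit [MeasurableSpace X] in
theorem hitCount_Ico_succ (D : Set X) (x : ℕ → X) (m K : ℕ) [Decidable (x m ∈ D)] :
    hitCount (Finset.Ico m (m + (K + 1))) D x =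
      (if x m ∈ D then 1 else 0) + hitCount (Finset.Ico (m + 1) (m + 1 + K)) D x := by
  classical
  rw [hitCount, show m + (K + 1) = m + 1 + K by omega,
    ← Finset.insert_Ico_add_one_left_eq_Ico (by omega), Finset.filter_insert]
  split_ifs
  · rw [Finset.card_insert_of_notMem (by simp), add_comm]; rfl
  · rw [zero_add]; rfl

/-- If the label budget does not run out, then all the labels are correct. -/
theorem run_secondBatch_eq (n : ℕ) (x : ℕ → X) (D : Set X)
    (infer : ℕ → List (X × Bool) → Classifier X)
    (hinfer : ∀ m L, x m ∉ D → (infer m L).1 (x m) = f.1 (x m)) (K m t : ℕ)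
    (L : List (X × Bool)) (ht : t + hitCount (Finset.Ico m (m + K)) D x ≤ n) :
    (secondBatch n x D infer K m t L).run (fun i => f.1 (x i)) =
      L ++ List.ofFn fun i : Fin K => (x (m + i), f.1 (x (m + i))) := by
  classical
  induction K generalizing m t L with
  | zero => simp [secondBatch, LabelProtocol.run]
  | succ K ih =>
    rw [hitCount_Ico_succ] at ht
    have hcons : (List.ofFn fun i : Fin (K + 1) => (x (m + i), f.1 (x (m + i)))) =
        (x m, f.1 (x m)) :: List.ofFn fun i : Fin K => (x (m + 1 + i), f.1 (x (m + 1 + i))) := by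
      simp [List.ofFn_succ, add_comm, add_left_comm]
    rw [secondBatch, hcons]
    by_cases hD : x m ∈ D
    · rw [if_pos hD] at ht
      rw [if_pos ⟨hD, by omega⟩, LabelProtocol.run, ih _ _ _ (by omega)]
      simp
    · rw [if_neg hD] at ht
      rw [if_neg fun h => hD h.1, ih _ _ _ (by omega), hinfer m L hD]
      simp

/-- The length `⌊n / (4 Δ̂)⌋` of the second batch. -/
noncomputable def batchSize (C : Set (Classifier X)) (f : Classifier X) (n : ℕ) (ω : ℕ → X) : ℕ :=
  ⌊(n : ℝ) / (4 * probEstimate n ω (sampleDisagreement C f (n / 2) ω))⌋₊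

omit [MeasurableSpace X] in
theorem probEstimate_eq (n : ℕ) (ω : ℕ → X) (D : Set X) :
    probEstimate n ω D =
      max (2 / (n : ℝ) ^ 2 * (hitCount (Finset.Ico (n ^ 2) (2 * n ^ 2)) D ω : ℝ)) (4 / (n : ℝ)) := by
  classical
  rw [probEstimate, hitCount]
  congr 2
  rw [Finset.sum_boole]

theorem run_metaAlgorithm0Sample (C : Set (Classifier X)) (f : Classifier X) (σ : SelectionRule X)
    (n : ℕ) (ω : ℕ → X) :
    (metaAlgorithm0Sample C σ n ω).run (fun i => f.1 (ω i)) =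
      (secondBatch n ω (sampleDisagreement C f (n / 2) ω)
        (σ.pick n ω (sampleVersionSpace C f (n / 2) ω)) (batchSize C f n ω) (n / 2) (n / 2)
        []).run fun i => f.1 (ω i) := by
  rw [metaAlgorithm0Sample, LabelProtocol.run_bind, run_requestFirst]
  simp only [versionSpace_ofFn]
  rfl

theorem length_run_metaAlgorithm0Sample (C : Set (Classifier X)) (f : Classifier X)
    (σ : SelectionRule X) (n : ℕ) (ω : ℕ → X) :
    ((metaAlgorithm0Sample C σ n ω).run fun i => f.1 (ω i)).length = batchSize C f n ω := by
  rw [run_metaAlgorithm0Sample, length_run_secondBatch, List.length_nil, zero_add]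

/-- The target lies in the version space, so outside the region of disagreement every choice of the
selection rule labels as `f` does. -/
theorem run_metaAlgorithm0Sample_eq (hf : f ∈ C) (σ : SelectionRule X) (n : ℕ) (ω : ℕ → X)
    (h : n / 2 + hitCount (Finset.Ico (n / 2) (n / 2 + batchSize C f n ω))
      (sampleDisagreement C f (n / 2) ω) ω ≤ n) :
    (metaAlgorithm0Sample C σ n ω).run (fun i => f.1 (ω i)) =
      List.ofFn fun i : Fin (batchSize C f n ω) => (ω (n / 2 + i), f.1 (ω (n / 2 + i))) := by
  rw [run_metaAlgorithm0Sample, run_secondBatch_eq _ _ _ _ ?_ _ _ _ _ h, List.nil_append]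
  intro m L hm
  have hmem := self_mem_sampleVersionSpace hf (n / 2) ω
  by_contra hne
  exact hm ⟨_, σ.pick_mem n ω _ m L ⟨f, hmem⟩, f, hmem, hne⟩

theorem run_metaAlgorithm0 (C : Set (Classifier X)) (f : Classifier X) (σ : SelectionRule X)
    (A : PassiveAlgorithm X) (n : ℕ) (s : A.Seed) (ω : ℕ → X) :
    ((metaAlgorithm0 C σ A).protocol n s ω).run (fun i => f.1 (ω i)) =
      A.learn s ((metaAlgorithm0Sample C σ n ω).run fun i => f.1 (ω i)) :=
  LabelProtocol.run_bind _ _ _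

/-- The second batch ends before the examples used by the estimator. -/
theorem half_add_batchSize_le (C : Set (Classifier X)) (f : Classifier X) (n : ℕ) (ω : ℕ → X) :
    n / 2 + batchSize C f n ω ≤ n ^ 2 := by
  rcases Nat.eq_zero_or_pos n with rfl | hn
  · simp [batchSize]
  have hn' : (1 : ℝ) ≤ n := by exact_mod_cast hn
  have h1 : (4 : ℝ) / n ≤ probEstimate n ω (sampleDisagreement C f (n / 2) ω) := le_max_right _ _
  -- This is the role of the lower cutoff 4/n in the estimator.
  have h2 : (batchSize C f n ω : ℝ) ≤ (n : ℝ) ^ 2 / 16 := by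
    refine (Nat.floor_le (div_nonneg (by positivity) ?_)).trans ?_
    · exact mul_nonneg (by norm_num) (le_trans (by positivity) h1)
    · calc (n : ℝ) / (4 * probEstimate n ω (sampleDisagreement C f (n / 2) ω))
          ≤ n / (4 * (4 / n)) := by gcongr
        _ = _ := by field_simp; norm_num
  have h3 : ((n / 2 : ℕ) : ℝ) ≤ n / 2 := Nat.cast_div_le
  have h4 : ((n / 2 + batchSize C f n ω : ℕ) : ℝ) ≤ ((n ^ 2 : ℕ) : ℝ) := by
    push_cast
    nlinarith
  exact_mod_cast h4

/-- The batch length ignores the examples of the batch itself and is therefore independent of them.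
-/
theorem batchSize_congr {n : ℕ} {ω ω' : ℕ → X} (h : ∀ i < n / 2, ω i = ω' i)
    (h' : ∀ i ∈ Finset.Ico (n ^ 2) (2 * n ^ 2), ω i = ω' i) :
    batchSize C f n ω = batchSize C f n ω' := by
  classical
  rw [batchSize, batchSize, sampleDisagreement_congr h, probEstimate_eq, probEstimate_eq]
  have : ∀ D : Set X, hitCount (Finset.Ico (n ^ 2) (2 * n ^ 2)) D ω =
      hitCount (Finset.Ico (n ^ 2) (2 * n ^ 2)) D ω' := fun D => by
    rw [hitCount, hitCount]
    congr 1
    exact Finset.filter_congr fun i hi => by rw [h' i hi]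
  rw [this]

end Sample

/-! ### Products of functions of disjoint sets of coordinates. -/

section Independence

variable {X : Type u} [MeasurableSpace X] (P : ProbabilityMeasure X)

theorem lintegral_mul_of_disjoint (J : Set ℕ) {F G : (ℕ → X) → ℝ≥0∞}
    (hF : AEMeasurable F (sampleLaw P)) (hG : AEMeasurable G (sampleLaw P))
    (hFJ : ∀ ω ω' : ℕ → X, (∀ i ∈ J, ω i = ω' i) → F ω = F ω')
    (hGJ : ∀ ω ω' : ℕ → X, (∀ i ∉ J, ω i = ω' i) → G ω = G ω') :
    ∫⁻ ω, F ω * G ω ∂(sampleLaw P) = (∫⁻ ω, F ω ∂(sampleLaw P)) * ∫⁻ ω, G ω ∂(sampleLaw P) := by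
  classical
  have hJ := measurePreserving_mergeSeq P J
  have h := lintegral_map' (f := fun ω => F ω * G ω) (g := mergeSeq J)
    (μ := (sampleLaw P).prod (sampleLaw P)) (by rw [hJ.map_eq]; exact hF.mul hG)
    hJ.measurable.aemeasurable
  rw [hJ.map_eq] at h
  rw [h, ← lintegral_prod_mul hF hG]
  refine lintegral_congr fun p => ?_
  rw [hFJ (mergeSeq J p) p.1 fun i hi => by simp [mergeSeq, hi],
    hGJ (mergeSeq J p) p.2 fun i hi => by simp [mergeSeq, hi]]

end Independence

/-! ### The failure event and its exponentially small probability. -/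

section Failure

variable {X : Type u} [MeasurableSpace X] {C : Set (Classifier X)} {f : Classifier X}

omit [MeasurableSpace X] in
theorem hitCount_congr {I : Finset ℕ} {D : Set X} {ω ω' : ℕ → X} (h : ∀ i ∈ I, ω i = ω' i) :
    hitCount I D ω = hitCount I D ω' := by
  classical
  rw [hitCount, hitCount]
  congr 1
  exact Finset.filter_congr fun i hi => by rw [h i hi]

theorem aemeasurable_hitCount_sampleDisagreement (hmeas : HasMeasurableTraces C) (hf : f ∈ C)
    (P : ProbabilityMeasure X) {a : ℕ} {I : Finset ℕ} (hI : ∀ i ∈ I, a ≤ i) :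
    AEMeasurable (fun ω => hitCount I (sampleDisagreement C f a ω) ω) (sampleLaw P) := by
  classical
  have : (fun ω : ℕ → X => hitCount I (sampleDisagreement C f a ω) ω) = fun ω =>
      ∑ i ∈ I, {ω : ℕ → X | ω i ∈ sampleDisagreement C f a ω}.indicator (fun _ => 1) ω := by
    ext ω
    rw [hitCount, Finset.card_filter]
    rfl
  rw [this]
  exact Finset.aemeasurable_fun_sum I fun i hi => aemeasurable_const.indicator₀
    (nullMeasurableSet_mem_sampleDisagreement hmeas hf P (hI i hi))

theorem aemeasurable_batchSize (hmeas : HasMeasurableTraces C) (hf : f ∈ C)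
    (P : ProbabilityMeasure X) (n : ℕ) :
    AEMeasurable (batchSize C f n) (sampleLaw P) := by
  have h := aemeasurable_hitCount_sampleDisagreement hmeas hf P (a := n / 2)
    (I := Finset.Ico (n ^ 2) (2 * n ^ 2)) (fun i hi => by
      have h1 := (Finset.mem_Ico.1 hi).1
      have h2 : n ≤ n ^ 2 := Nat.le_self_pow (by norm_num) n
      omega)
  have h2 := (Measurable.of_discrete (f := fun c : ℕ =>
    ⌊(n : ℝ) / (4 * max (2 / (n : ℝ) ^ 2 * (c : ℝ)) (4 / (n : ℝ)))⌋₊)).comp_aemeasurable h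
  refine h2.congr (Eventually.of_forall fun ω => ?_)
  simp only [Function.comp_apply, batchSize, probEstimate_eq]

/-- A large deviation of the estimator, or a second batch with too many requests. -/
def deviationEvent (C : Set (Classifier X)) (f : Classifier X) (P : ProbabilityMeasure X) (η : ℝ)
    (n : ℕ) : Set (ℕ → X) :=
  {ω | (P : Measure X).real (sampleDisagreement C f (n / 2) ω) ≤ η ∧
    (4 * η * n ^ 2 ≤ hitCount (Finset.Ico (n ^ 2) (2 * n ^ 2)) (sampleDisagreement C f (n / 2) ω) ω ∨
    (4 / n ≤ (P : Measure X).real (sampleDisagreement C f (n / 2) ω) ∧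
      (hitCount (Finset.Ico (n ^ 2) (2 * n ^ 2)) (sampleDisagreement C f (n / 2) ω) ω : ℝ) ≤
        (P : Measure X).real (sampleDisagreement C f (n / 2) ω) * n ^ 2 / 2) ∨
    ∃ k ∈ Finset.range (n ^ 2 + 1),
      (P : Measure X).real (sampleDisagreement C f (n / 2) ω) * k ≤ n / 4 ∧
      (n / 2 : ℝ) ≤ hitCount (Finset.Ico (n / 2) (n / 2 + k))
        (sampleDisagreement C f (n / 2) ω) ω)}

theorem nullMeasurableSet_deviationEvent (hmeas : HasMeasurableTraces C) (hf : f ∈ C)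
    (P : ProbabilityMeasure X) (η : ℝ) (n : ℕ) :
    NullMeasurableSet (deviationEvent C f P η n) (sampleLaw P) := by
  have hq : AEMeasurable (fun ω => (P : Measure X).real (sampleDisagreement C f (n / 2) ω))
      (sampleLaw P) := (aemeasurable_measure_sampleDisagreement hmeas hf P (n / 2)).ennreal_toReal
  have hcast : Measurable fun c : ℕ => (c : ℝ) := Measurable.of_discrete
  have h1 := hcast.comp_aemeasurable (aemeasurable_hitCount_sampleDisagreement hmeas hf P
    (a := n / 2) (I := Finset.Ico (n ^ 2) (2 * n ^ 2)) (fun i hi => by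
      have h1 := (Finset.mem_Ico.1 hi).1
      have h2 : n ≤ n ^ 2 := Nat.le_self_pow (by norm_num) n
      omega))
  have h2 := fun k => hcast.comp_aemeasurable (aemeasurable_hitCount_sampleDisagreement hmeas hf P
    (a := n / 2) (I := Finset.Ico (n / 2) (n / 2 + k)) (fun i hi => (Finset.mem_Ico.1 hi).1))
  refine (nullMeasurableSet_le hq aemeasurable_const).inter (.union ?_ (.union (.inter ?_ ?_) ?_))
  · exact nullMeasurableSet_le aemeasurable_const h1
  · exact nullMeasurableSet_le aemeasurable_const hq
  · exact nullMeasurableSet_le h1 ((hq.mul_const _).div_const _)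
  · have : {ω : ℕ → X | ∃ k ∈ Finset.range (n ^ 2 + 1),
        (P : Measure X).real (sampleDisagreement C f (n / 2) ω) * k ≤ n / 4 ∧
        (n / 2 : ℝ) ≤ hitCount (Finset.Ico (n / 2) (n / 2 + k))
          (sampleDisagreement C f (n / 2) ω) ω} = ⋃ k ∈ Finset.range (n ^ 2 + 1),
        ({ω : ℕ → X | (P : Measure X).real (sampleDisagreement C f (n / 2) ω) * k ≤ n / 4} ∩
        {ω : ℕ → X | (n / 2 : ℝ) ≤ hitCount (Finset.Ico (n / 2) (n / 2 + k))
          (sampleDisagreement C f (n / 2) ω) ω}) := by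
      ext ω
      simp only [Set.mem_iUnion, Set.mem_inter_iff, Set.mem_ofPred_eq, exists_prop]
    have h3 : NullMeasurableSet (⋃ k ∈ Finset.range (n ^ 2 + 1),
        ({ω : ℕ → X | (P : Measure X).real (sampleDisagreement C f (n / 2) ω) * k ≤ n / 4} ∩
        {ω : ℕ → X | (n / 2 : ℝ) ≤ hitCount (Finset.Ico (n / 2) (n / 2 + k))
          (sampleDisagreement C f (n / 2) ω) ω})) (sampleLaw P) :=
      .iUnion fun k => .iUnion fun _ => .inter
        (nullMeasurableSet_le (hq.mul_const _) aemeasurable_const)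
        (nullMeasurableSet_le aemeasurable_const (h2 k))
    rw [← this] at h3
    exact h3

/-- Three Chernoff bounds for a deterministic region: the estimator is too large, the estimator is
too small, some batch has too many hits. The union over all lengths up to n² avoids fixing the
random batch length. The exponents are at most -ηn, -2(1 - log 2)n and (1/4 - (log 2)/2)n; the last
two lie below -n/20. -/
theorem sampleLaw_deviation_of_fixed {D : Set X} (P : ProbabilityMeasure X)
    (hD : NullMeasurableSet D (P : Measure X)) {η : ℝ} {n : ℕ} (hn : 0 < n)
    (hDη : (P : Measure X).real D ≤ η) :
    sampleLaw P ({ω | 4 * η * n ^ 2 ≤ hitCount (Finset.Ico (n ^ 2) (2 * n ^ 2)) D ω} ∪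
      ({ω | 4 / n ≤ (P : Measure X).real D ∧
        (hitCount (Finset.Ico (n ^ 2) (2 * n ^ 2)) D ω : ℝ) ≤
          (P : Measure X).real D * n ^ 2 / 2} ∪
      ⋃ k ∈ Finset.range (n ^ 2 + 1), {ω | (P : Measure X).real D * k ≤ n / 4 ∧
        (n / 2 : ℝ) ≤ hitCount (Finset.Ico (n / 2) (n / 2 + k)) D ω})) ≤
    ENNReal.ofReal (Real.exp (-η * n) + Real.exp (-(1 / 20) * n) +
      (n ^ 2 + 1) * Real.exp (-(1 / 20) * n)) := by
  set q := (P : Measure X).real D with hq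
  have hq0 : 0 ≤ q := measureReal_nonneg
  have hn' : (1 : ℝ) ≤ n := by exact_mod_cast hn
  have hl1 := Real.log_two_gt_d9
  have hl2 := Real.log_two_lt_d9
  have hcard : (Finset.Ico (n ^ 2) (2 * n ^ 2)).card = n ^ 2 := by simp; omega
  rw [ENNReal.ofReal_add (by positivity) (by positivity), ENNReal.ofReal_add (by positivity)
    (by positivity), add_assoc]
  refine (measure_union_le _ _).trans (add_le_add ?_ ((measure_union_le _ _).trans
    (add_le_add ?_ ?_)))
  · refine (sampleLaw_le_hitCount_le P D _ _).trans (ENNReal.ofReal_le_ofReal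
      (Real.exp_le_exp.2 ?_))
    rw [hcard, ← hq]
    push_cast
    have h1 : q * (n : ℝ) ^ 2 ≤ η * n ^ 2 := by gcongr
    have h2 : 0 ≤ η := hq0.trans hDη
    have h3 : η * (n : ℝ) ≤ η * n ^ 2 := by gcongr; nlinarith
    have h4 : 0 ≤ η * (n : ℝ) ^ 2 := by positivity
    nlinarith
  · by_cases h4 : 4 / n ≤ q
    · simp only [h4, true_and]
      refine (sampleLaw_hitCount_le_le P hD _ _).trans (ENNReal.ofReal_le_ofReal
        (Real.exp_le_exp.2 ?_))
      rw [hcard, ← hq]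
      push_cast
      have h5 : 4 ≤ q * n := by rwa [div_le_iff₀ (by positivity)] at h4
      have h6 : 4 * (n : ℝ) ≤ q * n ^ 2 := by nlinarith
      nlinarith
    · have : {ω : ℕ → X | 4 / n ≤ q ∧ (hitCount (Finset.Ico (n ^ 2) (2 * n ^ 2)) D ω : ℝ) ≤
          q * n ^ 2 / 2} = ∅ := by ext; simp [h4]
      rw [this, measure_empty]
      exact zero_le
  · refine (measure_biUnion_finset_le _ _).trans ((Finset.sum_le_card_nsmul _ _
      (ENNReal.ofReal (Real.exp (-(1 / 20) * n))) fun k _ => ?_).trans (le_of_eq ?_))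
    · by_cases h4 : q * k ≤ n / 4
      · simp only [h4, true_and]
        refine (sampleLaw_le_hitCount_le P D _ _).trans (ENNReal.ofReal_le_ofReal
          (Real.exp_le_exp.2 ?_))
        rw [Nat.card_Ico, ← hq, Nat.add_sub_cancel_left]
        nlinarith
      · have : {ω : ℕ → X | q * k ≤ n / 4 ∧ (n / 2 : ℝ) ≤
            hitCount (Finset.Ico (n / 2) (n / 2 + k)) D ω} = ∅ := by ext; simp [h4]
        rw [this, measure_empty]
        exact zero_le
    · rw [Finset.card_range, nsmul_eq_mul, ENNReal.ofReal_mul (by positivity)]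
      congr 1
      rw [← ENNReal.ofReal_natCast]
      push_cast
      rfl

/-- Conditionally on the first `n / 2` examples the region of disagreement is fixed, almost surely
null-measurable, and independent of the examples counted afterwards. -/
theorem sampleLaw_deviationEvent_le (hmeas : HasMeasurableTraces C) (hf : f ∈ C)
    (P : ProbabilityMeasure X) (η : ℝ) {n : ℕ} (hn : 0 < n) :
    sampleLaw P (deviationEvent C f P η n) ≤
      ENNReal.ofReal (Real.exp (-η * n) + Real.exp (-(1 / 20) * n) +
        (n ^ 2 + 1) * Real.exp (-(1 / 20) * n)) := by
  classical
  rw [sampleLaw_apply_merge P {i | i < n / 2} (nullMeasurableSet_deviationEvent hmeas hf P η n)]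
  refine (lintegral_mono_ae (g := fun _ => ENNReal.ofReal (Real.exp (-η * n) +
    Real.exp (-(1 / 20) * n) + (n ^ 2 + 1) * Real.exp (-(1 / 20) * n))) ?_).trans (by simp)
  filter_upwards [(nullMeasurableSet_sampleDisagreement hmeas hf P (n / 2)).ae_prodMk_left]
    with ω hω
  have hω' : NullMeasurableSet (sampleDisagreement C f (n / 2) ω) (P : Measure X) := hω
  have hDeq : ∀ ω', sampleDisagreement C f (n / 2) (mergeSeq {i | i < n / 2} (ω, ω')) =
      sampleDisagreement C f (n / 2) ω := fun ω' =>
    sampleDisagreement_congr fun i hi => by simp [mergeSeq, hi]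
  have hhit : ∀ (I : Finset ℕ) (_ : ∀ i ∈ I, n / 2 ≤ i) (D : Set X) (ω' : ℕ → X),
      hitCount I D (mergeSeq {i | i < n / 2} (ω, ω')) = hitCount I D ω' := fun I hI D ω' =>
    hitCount_congr fun i hi => by
      have : ¬ i < n / 2 := not_lt.2 (hI i hi)
      simp [mergeSeq, this]
  have hI1 : ∀ i ∈ Finset.Ico (n ^ 2) (2 * n ^ 2), n / 2 ≤ i := fun i hi => by
    have h1 := (Finset.mem_Ico.1 hi).1
    have h2 : n ≤ n ^ 2 := Nat.le_self_pow (by norm_num) n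
    omega
  by_cases hη : (P : Measure X).real (sampleDisagreement C f (n / 2) ω) ≤ η
  · refine le_trans (measure_mono ?_) (sampleLaw_deviation_of_fixed P hω' hn hη)
    rintro ω' ⟨-, h⟩
    rw [hDeq, hhit _ hI1] at h
    rcases h with h | h | ⟨k, hk, h1, h2⟩
    · exact Or.inl h
    · exact Or.inr (Or.inl h)
    · refine Or.inr (Or.inr (Set.mem_iUnion₂.2 ⟨k, hk, h1, ?_⟩))
      rwa [hhit _ fun i hi => (Finset.mem_Ico.1 hi).1] at h2
  · have : {ω' : ℕ → X | mergeSeq {i | i < n / 2} (ω, ω') ∈ deviationEvent C f P η n} = ∅ := by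
      ext ω'
      simp only [deviationEvent, Set.mem_ofPred_eq, hDeq, hη, false_and, Set.mem_empty_iff_false]
    rw [this, measure_empty]
    exact zero_le

/-- The event on which the meta-algorithm may fail to construct a long correct sample. -/
def failureEvent (C : Set (Classifier X)) (f : Classifier X) (P : ProbabilityMeasure X) (η : ℝ)
    (n : ℕ) : Set (ℕ → X) :=
  largeDisagreementEvent C f P (ENNReal.ofReal η) (n / 2) ∪ deviationEvent C f P η n

theorem exists_sampleLaw_failureEvent_le (hVC : IsVCClass C) (hmeas : HasMeasurableTraces C)
    (hf : f ∈ C) (P : ProbabilityMeasure X)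
    (hcore : (P : Measure X) (disagreementCore C P f) = 0) {η : ℝ} (hη : 0 < η) :
    ∃ c : ℝ, 0 < c ∧ ∀ᶠ n : ℕ in atTop,
      sampleLaw P (failureEvent C f P η n) ≤ ENNReal.ofReal (Real.exp (-c * n)) := by
  obtain ⟨m, hm0, hm⟩ := exists_sampleLaw_largeDisagreementEvent_le hVC hmeas hf P hcore
    (η := ENNReal.ofReal η) (by simpa using hη) ENNReal.ofReal_ne_top
  have hm0' : (0 : ℝ) < m := by exact_mod_cast hm0
  have hlog : 0 < Real.log 2 := Real.log_pos (by norm_num)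
  set b : ℝ := min (min η (1 / 20)) (Real.log 2 / (2 * m)) with hb
  have hb0 : 0 < b := lt_min (lt_min hη (by norm_num)) (by positivity)
  have hb1 : b ≤ η := (min_le_left _ _).trans (min_le_left _ _)
  have hb2 : b ≤ 1 / 20 := (min_le_left _ _).trans (min_le_right _ _)
  have hb3 : b ≤ Real.log 2 / (2 * m) := min_le_right _ _
  refine ⟨b / 2, by positivity, ?_⟩
  -- All terms decay at rate `b` and their coefficients add up to n² + 7; giving up half the rate
  -- absorbs them.
  have hlim : Tendsto (fun n : ℕ => ((n : ℝ) ^ 2 + 7) * Real.exp (-(b / 2) * n)) atTop (𝓝 0) := by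
    have habs : |Real.exp (-(b / 2))| < 1 := by
      rw [abs_of_pos (Real.exp_pos _), Real.exp_lt_one_iff]
      linarith
    have h1 := tendsto_pow_const_mul_const_pow_of_abs_lt_one 2 habs
    have h2 := (tendsto_pow_atTop_nhds_zero_of_abs_lt_one habs).const_mul 7
    have h3 := h1.add h2
    rw [mul_zero, add_zero] at h3
    refine h3.congr fun n => ?_
    rw [← Real.exp_nat_mul, ← add_mul, mul_comm (n : ℝ) (-(b / 2))]
  filter_upwards [hlim.eventually_le_const (show (0 : ℝ) < 1 by norm_num), eventually_gt_atTop 0]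
    with n hn hn0
  -- The factor 4 pays for rounding down in the exponent `n / 2 / m`.
  have h1 : sampleLaw P (largeDisagreementEvent C f P (ENNReal.ofReal η) (n / 2)) ≤
      ENNReal.ofReal (4 * Real.exp (-b * n)) := by
    refine (hm _).trans ?_
    have h2 : ((1 : ℝ≥0∞) / 2) ^ (n / 2 / m) = ENNReal.ofReal ((1 / 2) ^ (n / 2 / m)) := by
      rw [ENNReal.ofReal_pow (by norm_num), ENNReal.ofReal_div_of_pos (by norm_num)]
      simp
    rw [h2]
    refine ENNReal.ofReal_le_ofReal ?_
    have h3 : ((1 : ℝ) / 2) ^ (n / 2 / m) = Real.exp (-Real.log 2 * (n / 2 / m : ℕ)) := by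
      rw [mul_comm, Real.exp_nat_mul, Real.exp_neg, Real.exp_log (by norm_num), one_div]
    have h4 : (n : ℝ) / (2 * m) ≤ (n / 2 / m : ℕ) + 1 := by
      rw [div_le_iff₀ (by positivity), Nat.div_div_eq_div_mul]
      have := Nat.lt_div_mul_add (a := n) (b := 2 * m) (by omega)
      have h5 : (n : ℝ) < (n / (2 * m) : ℕ) * (2 * m) + 2 * m := by exact_mod_cast this
      linarith
    have h5 : (4 : ℝ) = Real.exp (2 * Real.log 2) := by
      rw [two_mul, Real.exp_add, Real.exp_log (by norm_num)]; norm_num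
    rw [h3, h5, ← Real.exp_add]
    refine Real.exp_le_exp.2 ?_
    have h6 : b * n ≤ Real.log 2 * (n / (2 * m)) := by
      rw [mul_div_assoc', mul_comm (Real.log 2), mul_div_assoc, mul_comm]
      gcongr
    nlinarith
  have h2 := sampleLaw_deviationEvent_le hmeas hf P η hn0
  refine (measure_union_le _ _).trans ((add_le_add h1 h2).trans ?_)
  rw [← ENNReal.ofReal_add (by positivity) (by positivity)]
  refine ENNReal.ofReal_le_ofReal ?_
  have e1 : Real.exp (-η * n) ≤ Real.exp (-b * n) := by gcongr
  have e2 : Real.exp (-(1 / 20) * n) ≤ Real.exp (-b * n) := by gcongr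
  have e3 : Real.exp (-b * n) = Real.exp (-(b / 2) * n) * Real.exp (-(b / 2) * n) := by
    rw [← Real.exp_add]; congr 1; ring
  calc 4 * Real.exp (-b * n) + (Real.exp (-η * n) + Real.exp (-(1 / 20) * n) +
        (n ^ 2 + 1) * Real.exp (-(1 / 20) * n))
      ≤ 4 * Real.exp (-b * n) + (Real.exp (-b * n) + Real.exp (-b * n) +
        (n ^ 2 + 1) * Real.exp (-b * n)) := by gcongr
    _ = ((n : ℝ) ^ 2 + 7) * Real.exp (-b * n) := by ring
    _ = (((n : ℝ) ^ 2 + 7) * Real.exp (-(b / 2) * n)) * Real.exp (-(b / 2) * n) := by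
        rw [e3]; ring
    _ ≤ 1 * Real.exp (-(b / 2) * n) := by gcongr
    _ = _ := one_mul _

/-- Off the failure event, the constructed sample is long and the budget suffices. -/
theorem batchSize_spec_of_notMem_failureEvent (P : ProbabilityMeasure X) {η : ℝ} (hη : 0 < η)
    {n : ℕ} (hn0 : 0 < n) (hn : 1 ≤ 2 * η * n) {ω : ℕ → X} (hω : ω ∉ failureEvent C f P η n)
    {N : ℕ} (hN : N * (32 * η) ≤ n) :
    N ≤ batchSize C f n ω ∧ n / 2 + hitCount (Finset.Ico (n / 2) (n / 2 + batchSize C f n ω))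
      (sampleDisagreement C f (n / 2) ω) ω ≤ n := by
  have hK := half_add_batchSize_le C f n ω
  have hn' : (0 : ℝ) < n := by exact_mod_cast hn0
  rw [failureEvent, Set.mem_union, not_or] at hω
  obtain ⟨h1, h2⟩ := hω
  set D := sampleDisagreement C f (n / 2) ω with hD
  have hq : (P : Measure X).real D ≤ η := by
    have h3 : (P : Measure X) D ≤ ENNReal.ofReal η := not_lt.1 h1
    exact ENNReal.toReal_le_of_le_ofReal hη.le h3
  have h3 := not_and.1 h2 hq
  simp only [← hD, not_or, not_and, not_exists] at h3
  push Not at h3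
  obtain ⟨h4, h5, h6⟩ := h3
  set Δ := probEstimate n ω D with hΔ
  have hΔ4 : 4 / (n : ℝ) ≤ Δ := le_max_right _ _
  have hΔ0 : 0 < Δ := lt_of_lt_of_le (by positivity) hΔ4
  have hΔ8 : Δ ≤ 8 * η := by
    rw [hΔ, probEstimate_eq]
    refine max_le ?_ ?_
    · rw [div_mul_eq_mul_div, div_le_iff₀ (by positivity)]
      linarith
    · rw [div_le_iff₀ hn']
      linarith
  have hΔq : (P : Measure X).real D ≤ Δ := by
    -- If the region is smaller than 4/n, the cutoff already dominates it; otherwise the lower-tail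
    -- bound does.
    by_cases h : 4 / (n : ℝ) ≤ (P : Measure X).real D
    · refine le_trans ?_ ((le_max_left _ _).trans (probEstimate_eq n ω D).ge)
      rw [div_mul_eq_mul_div, le_div_iff₀ (by positivity)]
      linarith [h5 h]
    · exact (not_le.1 h).le.trans hΔ4
  have hKdef : batchSize C f n ω = ⌊(n : ℝ) / (4 * Δ)⌋₊ := rfl
  refine ⟨?_, ?_⟩
  · rw [hKdef, Nat.le_floor_iff (by positivity), le_div_iff₀ (by positivity)]
    exact (mul_le_mul_of_nonneg_left (by linarith) (Nat.cast_nonneg N)).trans hN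
  · have hKle : (batchSize C f n ω : ℝ) ≤ n / (4 * Δ) := by
      rw [hKdef]; exact Nat.floor_le (by positivity)
    have h7 := h6 (batchSize C f n ω) (by rw [Finset.mem_range]; omega) (by
      rw [le_div_iff₀ (by positivity)] at hKle
      have := mul_le_mul_of_nonneg_right hΔq (Nat.cast_nonneg (α := ℝ) (batchSize C f n ω))
      linarith)
    have h8 : ((n / 2 : ℕ) : ℝ) ≤ n / 2 := Nat.cast_div_le
    have h9 : ((n / 2 : ℕ) : ℝ) + hitCount (Finset.Ico (n / 2) (n / 2 + batchSize C f n ω)) D ω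
        ≤ n := by linarith
    exact_mod_cast h9

end Failure

/-! ### Null cores suffice. -/

section Upper

variable {X : Type u} [MeasurableSpace X] {C : Set (Classifier X)} {f : Classifier X}

theorem errorRate_le_one (P : ProbabilityMeasure X) (f h : Classifier X) : errorRate P f h ≤ 1 :=
  prob_le_one

/-- The error rate of `A` on the first `k` examples. -/
noncomputable def PassiveAlgorithm.sampleError (A : PassiveAlgorithm X) (f : Classifier X)
    (P : ProbabilityMeasure X) (k : ℕ) (p : (ℕ → X) × A.Seed) : ℝ≥0∞ :=
  errorRate P f (A.learn p.2 (List.ofFn fun i : Fin k => (p.1 i, f.1 (p.1 i))))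

theorem PassiveAlgorithm.measurable_sampleError (A : PassiveAlgorithm X) (f : Classifier X)
    (P : ProbabilityMeasure X) (k : ℕ) : Measurable (A.sampleError f P k) := by
  have hf := f.2
  have h1 : Measurable fun z : ((ℕ → X) × A.Seed) × X =>
      (A.learn z.1.2 (List.ofFn fun i : Fin k => (z.1.1 i, f.1 (z.1.1 i)))).1 z.2 := by
    refine (A.measurable_learn k).comp (g := fun p : A.Seed × (Fin k → X × Bool) × X =>
      (A.learn p.1 (List.ofFn p.2.1)).1 p.2.2)
      (f := fun z : ((ℕ → X) × A.Seed) × X =>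
        (z.1.2, (fun i : Fin k => (z.1.1 i, f.1 (z.1.1 i))), z.2)) ?_
    refine (measurable_snd.comp measurable_fst).prodMk (Measurable.prodMk ?_ measurable_snd)
    refine measurable_pi_lambda _ fun i => ?_
    have h2 : Measurable fun z : ((ℕ → X) × A.Seed) × X => z.1.1 (i : ℕ) :=
      (measurable_pi_apply _).comp (measurable_fst.comp measurable_fst)
    exact h2.prodMk (hf.comp h2)
  have h2 : MeasurableSet {z : ((ℕ → X) × A.Seed) × X |
      (A.learn z.1.2 (List.ofFn fun i : Fin k => (z.1.1 i, f.1 (z.1.1 i)))).1 z.2 ≠ f.1 z.2} :=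
    (measurableSet_eq_fun h1 (hf.comp measurable_snd)).compl
  exact measurable_measure_prodMk_left h2

theorem PassiveAlgorithm.lintegral_sampleError (A : PassiveAlgorithm X) (f : Classifier X)
    (P : ProbabilityMeasure X) (k : ℕ) :
    ∫⁻ ω, ∫⁻ s, A.sampleError f P k (ω, s) ∂(A.law : Measure A.Seed) ∂(sampleLaw P) =
      A.expectedError f P k :=
  (lintegral_prod _ (A.measurable_sampleError f P k).aemeasurable).symm

/-- Off the failure event, split by the batch length `k`. The event that the length is `k` depends
on the examples before `n / 2` and from n² on, the error of `A` on the others, so the expectations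
multiply. -/
theorem expectedError_metaAlgorithm0_le (hmeas : HasMeasurableTraces C) (hf : f ∈ C)
    (σ : SelectionRule X) (A : PassiveAlgorithm X) (P : ProbabilityMeasure X) {η : ℝ} (hη : 0 < η)
    {n : ℕ} (hn0 : 0 < n) (hn : 1 ≤ 2 * η * n) {N : ℕ} (hN : N * (32 * η) ≤ n) {ε : ℝ≥0∞}
    (hε : ∀ k, N ≤ k → A.expectedError f P k ≤ ε) :
    (metaAlgorithm0 C σ A).expectedError f P n ≤ sampleLaw P (failureEvent C f P η n) + ε := by
  classical
  set a := n / 2 with ha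
  let K := batchSize C f n
  have hK : AEMeasurable K (sampleLaw P) := aemeasurable_batchSize hmeas hf P n
  have hF : NullMeasurableSet (failureEvent C f P η n) (sampleLaw P) :=
    (nullMeasurableSet_largeDisagreementEvent hmeas hf P _ _).union
      (nullMeasurableSet_deviationEvent hmeas hf P η n)
  let sh : (ℕ → X) → (ℕ → X) := fun ω i => ω (a + i)
  have hsh : MeasurePreserving sh (sampleLaw P) (sampleLaw P) :=
    measurePreserving_reindex P (j := fun i => a + i) (add_right_injective _)
  let F : (ℕ → X) → ℝ≥0∞ := (failureEvent C f P η n).indicator 1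
  let T : ℕ → (ℕ → X) → ℝ≥0∞ := fun k => {ω | K ω = k}.indicator 1
  let e : ℕ → (ℕ → X) × A.Seed → ℝ≥0∞ := fun k p => A.sampleError f P k (sh p.1, p.2)
  have hTset : ∀ k, NullMeasurableSet {ω | K ω = k} (sampleLaw P) := fun k =>
    nullMeasurableSet_eq_fun hK aemeasurable_const
  have hFm : AEMeasurable F (sampleLaw P) := aemeasurable_const.indicator₀ hF
  have hTm : ∀ k, AEMeasurable (T k) (sampleLaw P) := fun k =>
    aemeasurable_const.indicator₀ (hTset k)
  have hem : ∀ k, Measurable (e k) := fun k => (A.measurable_sampleError f P k).comp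
    ((hsh.measurable.comp measurable_fst).prodMk measurable_snd)
  let S : Finset ℕ := Finset.Icc N (n ^ 2)
  let g : (ℕ → X) × A.Seed → ℝ≥0∞ := fun p => F p.1 + ∑ k ∈ S, T k p.1 * e k p
  have hq := Measure.quasiMeasurePreserving_fst (μ := sampleLaw P) (ν := (A.law : Measure A.Seed))
  have hFm' : AEMeasurable (fun p : (ℕ → X) × A.Seed => F p.1)
      ((sampleLaw P).prod (A.law : Measure A.Seed)) := hFm.comp_quasiMeasurePreserving hq
  have hTe : ∀ k, AEMeasurable (fun p : (ℕ → X) × A.Seed => T k p.1 * e k p)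
      ((sampleLaw P).prod (A.law : Measure A.Seed)) := fun k =>
    ((hTm k).comp_quasiMeasurePreserving hq).mul (hem k).aemeasurable
  have hgm : AEMeasurable g ((sampleLaw P).prod (A.law : Measure A.Seed)) :=
    hFm'.add (Finset.aemeasurable_fun_sum _ fun k _ => hTe k)
  have hle : ∀ p : (ℕ → X) × A.Seed, errorRate P f
      (((metaAlgorithm0 C σ A).protocol n p.2 p.1).run fun i => f.1 (p.1 i)) ≤ g p := by
    rintro ⟨ω, s⟩
    by_cases hω : ω ∈ failureEvent C f P η n
    · refine (errorRate_le_one P f _).trans (le_trans ?_ le_self_add)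
      simp [F, hω]
    · obtain ⟨h1, h2⟩ := batchSize_spec_of_notMem_failureEvent P hη hn0 hn hω hN
      refine le_trans ?_ le_add_self
      refine le_trans ?_ (Finset.single_le_sum (f := fun k => T k ω * e k (ω, s))
        (fun _ _ => zero_le) (Finset.mem_Icc.2 ⟨h1, le_of_add_le_right
          (half_add_batchSize_le C f n ω)⟩))
      have hT : T (batchSize C f n ω) ω = 1 := by simp [T, K]
      rw [run_metaAlgorithm0, run_metaAlgorithm0Sample_eq hf σ n ω h2, hT, one_mul]
      exact le_rfl
  refine (outerExpectation_le_of_aemeasurable hgm (Eventually.of_forall hle)).trans ?_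
  have hem' : ∀ k, Measurable fun ω => ∫⁻ s, e k (ω, s) ∂(A.law : Measure A.Seed) := fun k =>
    (hem k).lintegral_prod_right'
  have hterm : ∀ k ∈ S, ∫⁻ p, T k p.1 * e k p ∂((sampleLaw P).prod (A.law : Measure A.Seed)) ≤
      sampleLaw P {ω | K ω = k} * ε := by
    intro k hk
    obtain ⟨hk1, hk2⟩ := Finset.mem_Icc.1 hk
    rw [lintegral_prod _ (hTe k)]
    have h1 : ∀ ω, ∫⁻ s, T k ω * e k (ω, s) ∂(A.law : Measure A.Seed) =
        T k ω * ∫⁻ s, e k (ω, s) ∂(A.law : Measure A.Seed) := fun ω =>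
      lintegral_const_mul _ ((hem k).comp measurable_prodMk_left)
    simp only [h1]
    -- For larger `k` the batch would overlap the estimator's examples, but such a length never
    -- occurs.
    by_cases hak : a + k ≤ n ^ 2
    · rw [lintegral_mul_of_disjoint P ({i | i < a} ∪ {i | n ^ 2 ≤ i}) (hTm k)
        (hem' k).aemeasurable, lintegral_indicator_one₀ (hTset k)]
      · gcongr
        have h2 : ∀ ω, ∫⁻ s, e k (ω, s) ∂(A.law : Measure A.Seed) =
          (fun ω => ∫⁻ s, A.sampleError f P k (ω, s) ∂(A.law : Measure A.Seed)) (sh ω) :=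
            fun ω => rfl
        simp only [h2]
        rw [hsh.lintegral_comp (A.measurable_sampleError f P k).lintegral_prod_right',
          A.lintegral_sampleError]
        exact hε k hk1
      · intro ω ω' h
        have h3 : K ω = K ω' := batchSize_congr (fun i hi => h i (Or.inl hi)) fun i hi =>
          h i (Or.inr (Finset.mem_Ico.1 hi).1)
        simp [T, Set.indicator_apply, h3]
      · intro ω ω' h
        refine lintegral_congr fun s => ?_
        simp only [e, PassiveAlgorithm.sampleError, sh]
        have h3 : ∀ i : Fin k, ω (a + i) = ω' (a + i) := fun i => h _ (by
          simp only [Set.mem_union, Set.mem_ofPred_eq]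
          omega)
        simp only [h3]
    · have h0 : ∀ ω, T k ω = 0 := fun ω => by
        have : K ω ≠ k := fun h => hak (h ▸ half_add_batchSize_le C f n ω)
        simp [T, this]
      simp [h0]
  calc ∫⁻ p, g p ∂((sampleLaw P).prod (A.law : Measure A.Seed))
      = ∫⁻ p, F p.1 ∂((sampleLaw P).prod (A.law : Measure A.Seed)) +
        ∑ k ∈ S, ∫⁻ p, T k p.1 * e k p ∂((sampleLaw P).prod (A.law : Measure A.Seed)) := by
        simp only [g]
        rw [lintegral_add_left' hFm', lintegral_finsetSum' _ fun k _ => hTe k]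
    _ ≤ sampleLaw P (failureEvent C f P η n) + ∑ k ∈ S, sampleLaw P {ω | K ω = k} * ε := by
        refine add_le_add (le_of_eq ?_) (Finset.sum_le_sum hterm)
        rw [lintegral_prod _ hFm']
        simp only [lintegral_const, measure_univ, mul_one]
        exact lintegral_indicator_one₀ hF
    _ ≤ sampleLaw P (failureEvent C f P η n) + ε := by
        gcongr
        rw [← Finset.sum_mul]
        refine mul_le_of_le_one_left' ?_
        rw [← measure_biUnion_finset₀ (fun i _ j _ hij => Disjoint.aedisjoint
          (Set.disjoint_left.2 fun ω h1 h2 => hij (h1.symm.trans h2))) fun k _ => hTset k]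
        exact prob_le_one

/-- The least label complexity with error rates `err`. -/
noncomputable def leastLabelComplexity (err : Classifier X → ProbabilityMeasure X → ℕ → ℝ≥0∞) :
    LabelComplexity X := fun ε f P =>
  ⨅ (N : ℕ) (_ : 0 < N ∧ ∀ n, N ≤ n → err f P n ≤ ENNReal.ofReal ε), (N : ℕ∞)

theorem achieves_leastLabelComplexity (C : Set (Classifier X))
    (err : Classifier X → ProbabilityMeasure X → ℕ → ℝ≥0∞) :
    AchievesLabelComplexity C err (leastLabelComplexity err) := by
  intro f _ P ε _
  refine ⟨?_, fun n hn => ?_⟩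
  · refine lt_of_lt_of_le zero_lt_one (le_iInf₂ fun N hN => ?_)
    exact_mod_cast Nat.one_le_iff_ne_zero.2 hN.1.ne'
  · have h : leastLabelComplexity err ε f P < ((n + 1 : ℕ) : ℕ∞) :=
      hn.trans_lt (by exact_mod_cast Nat.lt_succ_self n)
    obtain ⟨N, hN⟩ := iInf_lt_iff.1 h
    obtain ⟨hN', hlt⟩ := iInf_lt_iff.1 hN
    exact hN'.2 n (Nat.lt_succ_iff.1 (by exact_mod_cast hlt))

theorem leastLabelComplexity_le {err : Classifier X → ProbabilityMeasure X → ℕ → ℝ≥0∞} {ε : ℝ}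
    {f : Classifier X} {P : ProbabilityMeasure X} {N : ℕ} (hN : 0 < N)
    (h : ∀ n, N ≤ n → err f P n ≤ ENNReal.ofReal ε) : leastLabelComplexity err ε f P ≤ N :=
  iInf₂_le N ⟨hN, h⟩

/-- Nontriviality enters the upper bound only through the polylogarithmic function log(1/ε). -/
theorem eventually_mul_log_le {Λ : LabelComplexity X} {P : ProbabilityMeasure X}
    (h : (f, P) ∈ NontrivialPairs Λ) {b : ℝ} (hb : 0 < b) :
    ∀ᶠ ε in 𝓝[>] (0 : ℝ), ENNReal.ofReal (b * Real.log (1 / ε)) ≤ (Λ ε f P : ℝ≥0∞) := by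
  have hg : (fun ε : ℝ => (Real.log (1 / ε)).toNNReal) ∈ Polylog := by
    refine ⟨1, zero_le_one, ?_⟩
    refine Asymptotics.IsBigO.of_bound 1 (Eventually.of_forall fun ε => ?_)
    simp only [Real.rpow_one, one_mul, Real.norm_eq_abs, Real.coe_toNNReal']
    rw [abs_of_nonneg (le_max_right _ _)]
    exact max_le (le_abs_self _) (abs_nonneg _)
  have h1 := (h.2 _ hg).eventually_le_const (u := ENNReal.ofReal b⁻¹) (by simpa using hb)
  have hpos : ∀ᶠ ε in 𝓝[>] (0 : ℝ), ε ∈ Set.Ioo (0 : ℝ) 1 := Ioo_mem_nhdsGT one_pos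
  filter_upwards [h1, hpos] with ε h2 h3
  have hfin : (Λ ε f P : ℝ≥0∞) ≠ ⊤ := by
    have := h.1 ε h3
    simpa using this.ne
  have hlog : 0 < Real.log (1 / ε) := Real.log_pos (by
    rw [one_div]; exact (one_lt_inv₀ h3.1).2 h3.2)
  rw [ENNReal.div_le_iff_le_mul (Or.inr (by simp)) (Or.inl hfin)] at h2
  calc ENNReal.ofReal (b * Real.log (1 / ε))
      = ENNReal.ofReal b * ((Real.log (1 / ε)).toNNReal : ℝ≥0∞) := ENNReal.ofReal_mul hb.le
    _ ≤ ENNReal.ofReal b * (ENNReal.ofReal b⁻¹ * (Λ ε f P : ℝ≥0∞)) := by gcongr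
    _ = (Λ ε f P : ℝ≥0∞) := by
        rw [← mul_assoc, ← ENNReal.ofReal_mul hb.le, mul_inv_cancel₀ hb.ne', ENNReal.ofReal_one,
          one_mul]

theorem isUniversalActivizer_of_core_null (hVC : IsVCClass C) (hmeas : HasMeasurableTraces C)
    (σ : SelectionRule X)
    (hcore : ∀ f ∈ C, ∀ P : ProbabilityMeasure X, (P : Measure X) (disagreementCore C P f) = 0) :
    IsUniversalActivizer (metaAlgorithm0 C σ) C := by
  intro A Λp hΛp
  refine ⟨leastLabelComplexity (metaAlgorithm0 C σ A).expectedError,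
    achieves_leastLabelComplexity C _, fun f hf P hnt => ⟨2, one_le_two, ?_⟩⟩
  refine ENNReal.tendsto_nhds_zero.2 fun δ' hδ' => ?_
  obtain ⟨δ, hδ, hδδ'⟩ : ∃ δ : ℝ, 0 < δ ∧ ENNReal.ofReal (2 * δ) ≤ δ' := by
    rcases eq_or_ne δ' ⊤ with rfl | htop
    · exact ⟨1, one_pos, le_top⟩
    · refine ⟨δ'.toReal / 2, half_pos (ENNReal.toReal_pos hδ'.ne' htop), ?_⟩
      rw [mul_div_cancel₀ _ two_ne_zero, ENNReal.ofReal_toReal htop]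
  set η := δ / 32 with hη
  have hη0 : 0 < η := by positivity
  obtain ⟨c, hc, hfail⟩ := exists_sampleLaw_failureEvent_le hVC hmeas hf P (hcore f hf P) hη0
  obtain ⟨n₀, hn₀⟩ := eventually_atTop.1 (hfail.and ((eventually_gt_atTop 0).and
    (tendsto_natCast_atTop_atTop.eventually_ge_atTop (1 / (2 * η)))))
  have hlog : Tendsto (fun ε : ℝ => Real.log (1 / ε)) (𝓝[>] 0) atTop := by
    simp only [one_div]
    exact Real.tendsto_log_atTop.comp tendsto_inv_nhdsGT_zero
  -- The first bound gives cδN ≥ log(1/ε), hence exp(-cn) ≤ ε once n ≥ δN. The second and third give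
  -- δN ≥ n₀ + 1; the extra 1 makes ⌈δN⌉ ≤ 2δN.
  filter_upwards [eventually_mul_log_le hnt (b := 1 / (c * δ)) (by positivity),
    eventually_mul_log_le hnt one_pos, hlog.eventually_ge_atTop ((n₀ + 1) / δ),
    Ioo_mem_nhdsGT (one_pos (α := ℝ))] with ε h1 h2 h3 hε
  obtain ⟨N, hN⟩ := ENat.ne_top_iff_exists.1 (hnt.1 ε hε).ne
  have hN : Λp ε f P = N := hN.symm
  rw [hN] at h1 h2 ⊢
  have hNpos : 0 < N := by
    have := (hΛp f hf P ε hε).1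
    rw [hN] at this
    exact_mod_cast this
  rw [ENat.toENNReal_coe, ← ENNReal.ofReal_natCast, ENNReal.ofReal_le_ofReal_iff (by positivity)]
    at h1 h2
  have hδN : (n₀ : ℝ) + 1 ≤ δ * N := by
    rw [one_mul] at h2
    have := h3.trans h2
    rwa [div_le_iff₀ hδ, mul_comm] at this
  have hceil : leastLabelComplexity (metaAlgorithm0 C σ A).expectedError (2 * ε) f P ≤
      (⌈δ * N⌉₊ : ℕ) := by
    refine leastLabelComplexity_le (Nat.ceil_pos.2 (by positivity)) fun n hn => ?_
    have hn' : δ * N ≤ n := Nat.ceil_le.1 hn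
    have hn0 : n₀ ≤ n := by
      have : (n₀ : ℝ) ≤ n := by linarith
      exact_mod_cast this
    obtain ⟨hf1, hf2, hf3⟩ := hn₀ n hn0
    refine (expectedError_metaAlgorithm0_le hmeas hf σ A P hη0 hf2 ?_ (N := N) ?_
      (ε := ENNReal.ofReal ε) fun k hk => ?_).trans ?_
    · rw [div_le_iff₀ (by positivity)] at hf3
      linarith
    · rw [hη]; linarith
    · exact (hΛp f hf P ε hε).2 k (by rw [hN]; exact_mod_cast hk)
    · rw [two_mul, ENNReal.ofReal_add hε.1.le hε.1.le]
      gcongr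
      refine hf1.trans (ENNReal.ofReal_le_ofReal ?_)
      rw [← Real.le_log_iff_exp_le hε.1]
      have h4 : Real.log (1 / ε) ≤ c * n := by
        rw [one_div_mul_eq_div, div_le_iff₀ (by positivity)] at h1
        calc Real.log (1 / ε) ≤ N * (c * δ) := h1
          _ = c * (δ * N) := by ring
          _ ≤ c * n := by gcongr
      rw [one_div, Real.log_inv] at h4
      linarith
  refine ENNReal.div_le_of_le_mul (le_trans (b := ENNReal.ofReal (2 * δ * N)) ?_ ?_)
  · refine (ENat.toENNReal_le.2 hceil).trans ?_
    rw [ENat.toENNReal_coe, ← ENNReal.ofReal_natCast]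
    refine ENNReal.ofReal_le_ofReal ?_
    have h5 := Nat.ceil_lt_add_one (a := δ * N) (by positivity)
    have h6 : (0 : ℝ) ≤ n₀ := Nat.cast_nonneg _
    linarith
  · rw [ENNReal.ofReal_mul (by positivity), ENNReal.ofReal_natCast, ENat.toENNReal_coe]
    gcongr

end Upper

/-! ### Null cores are necessary. -/

section Lower

variable {X : Type u} [MeasurableSpace X] {C : Set (Classifier X)} {f : Classifier X}

/-- The classifier that disagrees with `f` everywhere. -/
def flipClassifier (f : Classifier X) : Classifier X :=
  ⟨fun x => !f.1 x, (Measurable.of_discrete (f := Bool.not)).comp f.2⟩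

/-- The passive algorithm that ignores the examples in `L`, and returns `f`, or its negation with
probability `1 / |L|`. -/
noncomputable def decayingAlgorithm (f : Classifier X) : PassiveAlgorithm X where
  Seed := unitInterval
  law := ⟨volume, inferInstance⟩
  -- In product form the test always succeeds on the empty sample, and shorter samples only make it
  -- easier to satisfy.
  learn s L := if (s : ℝ) * L.length ≤ 1 then flipClassifier f else f
  measurable_learn n := by
    have h : (fun p : unitInterval × (Fin n → X × Bool) × X =>
        (if (p.1 : ℝ) * (List.ofFn p.2.1).length ≤ 1 then flipClassifier f else f).1 p.2.2) =
        fun p => if (p.1 : ℝ) * n ≤ 1 then (flipClassifier f).1 p.2.2 else f.1 p.2.2 := by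
      ext p
      rw [List.length_ofFn]
      split_ifs <;> rfl
    rw [h]
    refine Measurable.ite ?_ ((flipClassifier f).2.comp (measurable_snd.comp measurable_snd))
      (f.2.comp (measurable_snd.comp measurable_snd))
    exact measurableSet_le ((measurable_subtype_coe.comp measurable_fst).mul_const _)
      measurable_const

theorem learn_decayingAlgorithm (f : Classifier X) (s : unitInterval) (L : List (X × Bool)) :
    (decayingAlgorithm f).learn s L =
      if (s : ℝ) * L.length ≤ 1 then flipClassifier f else f := rfl

theorem errorRate_flipClassifier (P : ProbabilityMeasure X) (f : Classifier X) :
    errorRate P f (flipClassifier f) = 1 := by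
  have : {x | (flipClassifier f).1 x ≠ f.1 x} = Set.univ := by
    ext x; simp [flipClassifier]
  rw [errorRate, this, measure_univ]

theorem errorRate_self (P : ProbabilityMeasure X) (f : Classifier X) : errorRate P f f = 0 := by
  simp [errorRate]

theorem expectedError_decayingAlgorithm_le (f : Classifier X) (P : ProbabilityMeasure X) {n : ℕ}
    (hn : 0 < n) : (decayingAlgorithm f).expectedError f P n ≤ ENNReal.ofReal (1 / n) := by
  have hn' : (0 : ℝ) < n := by exact_mod_cast hn
  have hn1 : (1 : ℝ) ≤ n := by exact_mod_cast hn
  let t : unitInterval := ⟨1 / n, by positivity, by rw [div_le_one hn']; exact hn1⟩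
  refine le_of_eq ?_
  calc (decayingAlgorithm f).expectedError f P n
      = ∫⁻ p : (ℕ → X) × unitInterval, (Set.univ ×ˢ Set.Iic t).indicator 1 p
          ∂((sampleLaw P).prod volume) := by
        refine lintegral_congr fun p : (ℕ → X) × unitInterval => ?_
        have hiff : (p.2 : ℝ) * n ≤ 1 ↔ p ∈ (Set.univ : Set (ℕ → X)) ×ˢ Set.Iic t := by
          rw [← le_div_iff₀ hn']
          simp [t, ← Subtype.coe_le_coe]
        rw [learn_decayingAlgorithm, List.length_ofFn]
        by_cases h : (p.2 : ℝ) * n ≤ 1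
        · rw [if_pos h, Set.indicator_of_mem (hiff.1 h), errorRate_flipClassifier]; rfl
        · rw [if_neg h, Set.indicator_of_notMem (mt hiff.2 h), errorRate_self]
    _ = ENNReal.ofReal (1 / n) := by
        rw [lintegral_indicator_one (MeasurableSet.univ.prod measurableSet_Iic),
          Measure.prod_prod, measure_univ, one_mul, unitInterval.volume_Iic]

open Classical in
/-- A label complexity of `decayingAlgorithm f`. -/
noncomputable def decayingComplexity (f : Classifier X) : LabelComplexity X :=
  fun ε g _ => if g = f then (⌈1 / ε⌉₊ : ℕ) else ⊤

theorem decayingComplexity_self (f : Classifier X) (ε : ℝ) (P : ProbabilityMeasure X) :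
    decayingComplexity f ε f P = (⌈1 / ε⌉₊ : ℕ) := if_pos rfl

/-- Targets other than `f` have complexity `⊤`, which no budget reaches, so nothing is claimed
there. -/
theorem achieves_decayingComplexity (C : Set (Classifier X)) (f : Classifier X) :
    AchievesLabelComplexity C (decayingAlgorithm f).expectedError (decayingComplexity f) := by
  intro g _ P ε hε
  by_cases hg : g = f
  · subst hg
    rw [decayingComplexity_self]
    have hpos : 0 < ⌈1 / ε⌉₊ := Nat.ceil_pos.2 (one_div_pos.2 hε.1)
    refine ⟨by exact_mod_cast hpos, fun n hn => ?_⟩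
    have hn' : ⌈1 / ε⌉₊ ≤ n := by exact_mod_cast hn
    have hn0 : 0 < n := hpos.trans_le hn'
    refine (expectedError_decayingAlgorithm_le g P hn0).trans (ENNReal.ofReal_le_ofReal ?_)
    exact (one_div_le hε.1 (by exact_mod_cast hn0)).1 (Nat.ceil_le.1 hn')
  · simp [decayingComplexity, hg]

theorem mem_nontrivialPairs_decayingComplexity (f : Classifier X) (P : ProbabilityMeasure X) :
    (f, P) ∈ NontrivialPairs (decayingComplexity f) := by
  refine ⟨fun ε _ => by simp [decayingComplexity_self], fun g hg => ?_⟩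
  obtain ⟨k, -, hgk⟩ := hg
  have h1 : (fun ε : ℝ => Real.log (1 / ε) ^ k) =o[𝓝[>] 0] fun ε => ε⁻¹ := by
    have := (isLittleO_log_rpow_rpow_atTop k one_pos).comp_tendsto tendsto_inv_nhdsGT_zero
    refine this.congr (fun ε => ?_) fun ε => ?_
    · simp
    · simp
  have h2 := (hgk.trans_isLittleO h1).tendsto_div_nhds_zero
  have h3 := ENNReal.tendsto_ofReal h2
  rw [ENNReal.ofReal_zero] at h3
  refine tendsto_of_tendsto_of_tendsto_of_le_of_le' tendsto_const_nhds h3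
    (Eventually.of_forall fun _ => zero_le) ?_
  filter_upwards [self_mem_nhdsWithin] with ε hε
  have hε' : 0 < ε := hε
  simp only [decayingComplexity_self]
  rw [ENNReal.ofReal_div_of_pos (by positivity), ENNReal.ofReal_coe_nnreal, ENat.toENNReal_coe,
    ← ENNReal.ofReal_natCast]
  gcongr
  rw [← one_div]
  exact Nat.le_ceil _

/-! ### The region of disagreement contains almost all of the disagreement core -/

/-- For every r some `h ∈ C` within r of `f` differs from it at the core point `x`; it fits all `a`
examples except with probability at most ar. Let r tend to 0. -/
theorem sampleLaw_notMem_sampleDisagreement (hf : f ∈ C) (P : ProbabilityMeasure X) (a : ℕ) {x : X}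
    (hx : x ∈ disagreementCore C P f) :
    sampleLaw P {ω | x ∉ sampleDisagreement C f a ω} = 0 := by
  have key : ∀ r : ℝ, 0 < r →
      sampleLaw P {ω | x ∉ sampleDisagreement C f a ω} ≤ a * ENNReal.ofReal r := by
    intro r hr
    have hfr : f ∈ classifierBall C P f r := ⟨hf, by rw [errorRate_self]; exact zero_le⟩
    obtain ⟨h, hh, hne⟩ := (mem_disagreementRegion_iff hfr).1 (Set.mem_iInter₂.1 hx r hr)
    have hD : MeasurableSet {x | h.1 x ≠ f.1 x} := (measurableSet_eq_fun h.2 f.2).compl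
    calc sampleLaw P {ω | x ∉ sampleDisagreement C f a ω}
        ≤ sampleLaw P (⋃ i ∈ Finset.range a, (fun ω : ℕ → X => ω i) ⁻¹' {x | h.1 x ≠ f.1 x}) := by
          refine measure_mono fun ω hω => ?_
          by_contra hcon
          simp only [Set.mem_iUnion, Set.mem_preimage, Set.mem_ofPred_eq, not_exists, not_not,
            Finset.mem_range] at hcon
          exact hω ((mem_sampleDisagreement_iff hf).2 ⟨h, hh.1, hcon, hne⟩)
      _ ≤ ∑ i ∈ Finset.range a, sampleLaw P ((fun ω : ℕ → X => ω i) ⁻¹' {x | h.1 x ≠ f.1 x}) :=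
          measure_biUnion_finset_le _ _
      _ ≤ ∑ _i ∈ Finset.range a, ENNReal.ofReal r := by
          refine Finset.sum_le_sum fun i _ => ?_
          rw [(measurePreserving_eval_sampleLaw P i).measure_preimage hD.nullMeasurableSet]
          exact hh.2
      _ = a * ENNReal.ofReal r := by simp
  have hlim : Tendsto (fun r : ℝ => (a : ℝ≥0∞) * ENNReal.ofReal r) (𝓝[>] 0) (𝓝 0) := by
    have h1 : Tendsto (fun r : ℝ => ENNReal.ofReal r) (𝓝[>] 0) (𝓝 0) := by
      have := (ENNReal.continuous_ofReal.tendsto 0).mono_left (nhdsWithin_le_nhds (s := Set.Ioi 0))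
      rwa [ENNReal.ofReal_zero] at this
    have h2 := ENNReal.Tendsto.const_mul h1 (Or.inr (ENNReal.natCast_ne_top a))
    rwa [mul_zero] at h2
  refine le_antisymm (ge_of_tendsto hlim ?_) zero_le
  filter_upwards [self_mem_nhdsWithin] with r hr using key r hr

/-- Fubini with the test point outermost: every core point has a section of full measure. The core
need not be measurable, so it is compared with the set where the section of a measurable hull has
measure at least 1. -/
theorem measure_disagreementCore_le (hmeas : HasMeasurableTraces C) (hf : f ∈ C)
    (P : ProbabilityMeasure X) {a i : ℕ} (hai : a ≤ i) :
    (P : Measure X) (disagreementCore C P f) ≤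
      sampleLaw P {ω | ω i ∈ sampleDisagreement C f a ω} := by
  have hup := measurePreserving_update P i
  rw [← hup.measure_preimage (nullMeasurableSet_mem_sampleDisagreement hmeas hf P hai)]
  set G := (fun p : (ℕ → X) × X => Function.update p.1 i p.2) ⁻¹'
    {ω | ω i ∈ sampleDisagreement C f a ω} with hG
  set G' := toMeasurable ((sampleLaw P).prod (P : Measure X)) G with hG'
  have hG'm : MeasurableSet G' := measurableSet_toMeasurable _ _
  rw [← measure_toMeasurable G, Measure.prod_apply_symm hG'm]
  have h1 := mul_meas_ge_le_lintegral (μ := (P : Measure X))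
    (measurable_measure_prodMk_right (μ := sampleLaw P) hG'm) 1
  rw [one_mul] at h1
  refine le_trans (measure_mono fun x hx => ?_) h1
  have h2 := sampleLaw_notMem_sampleDisagreement hf P a hx
  calc (1 : ℝ≥0∞) = sampleLaw P Set.univ := measure_univ.symm
    _ ≤ sampleLaw P ({ω | x ∈ sampleDisagreement C f a ω} ∪
        {ω | x ∉ sampleDisagreement C f a ω}) := measure_mono fun ω _ => em _
    _ ≤ sampleLaw P {ω | x ∈ sampleDisagreement C f a ω} + 0 := by
        rw [← h2]; exact measure_union_le _ _
    _ ≤ _ := by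
        rw [add_zero]
        refine measure_mono fun ω hω => subset_toMeasurable _ _ ?_
        simpa [hG, sampleDisagreement_update hai] using hω

/-- Reverse Markov inequality: the hit count is at most |I| and its mean is at least p|I|, where p
is the measure of the core, so it reaches p|I|/2 with probability at least p/2. -/
theorem half_measure_disagreementCore_le (hmeas : HasMeasurableTraces C) (hf : f ∈ C)
    (P : ProbabilityMeasure X) {a : ℕ} {I : Finset ℕ} (hI : ∀ i ∈ I, a ≤ i) (hI0 : I.Nonempty) :
    (P : Measure X) (disagreementCore C P f) / 2 ≤ sampleLaw P {ω |
      (I.card : ℝ≥0∞) * ((P : Measure X) (disagreementCore C P f) / 2) ≤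
        hitCount I (sampleDisagreement C f a ω) ω} := by
  classical
  set p := (P : Measure X) (disagreementCore C P f) with hp
  set E : Set (ℕ → X) := {ω | (I.card : ℝ≥0∞) * (p / 2) ≤
    hitCount I (sampleDisagreement C f a ω) ω} with hE
  have hcast : Measurable fun c : ℕ => (c : ℝ≥0∞) := Measurable.of_discrete
  have hm := hcast.comp_aemeasurable (aemeasurable_hitCount_sampleDisagreement hmeas hf P hI)
  have hEm : NullMeasurableSet E (sampleLaw P) := nullMeasurableSet_le aemeasurable_const hm
  have hsum : (I.card : ℝ≥0∞) * p ≤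
      ∫⁻ ω, (hitCount I (sampleDisagreement C f a ω) ω : ℝ≥0∞) ∂(sampleLaw P) := by
    have h1 : ∀ ω : ℕ → X, (hitCount I (sampleDisagreement C f a ω) ω : ℝ≥0∞) =
        ∑ i ∈ I, {ω : ℕ → X | ω i ∈ sampleDisagreement C f a ω}.indicator 1 ω := by
      intro ω
      simp [hitCount, Set.indicator_apply]
    simp only [h1]
    rw [lintegral_finsetSum']
    · rw [← nsmul_eq_mul]
      refine Finset.card_nsmul_le_sum _ _ _ fun i hi => ?_
      rw [lintegral_indicator_one₀ (nullMeasurableSet_mem_sampleDisagreement hmeas hf P (hI i hi))]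
      exact measure_disagreementCore_le hmeas hf P (hI i hi)
    · intro i hi
      exact aemeasurable_const.indicator₀
        (nullMeasurableSet_mem_sampleDisagreement hmeas hf P (hI i hi))
  have hle : ∫⁻ ω, (hitCount I (sampleDisagreement C f a ω) ω : ℝ≥0∞) ∂(sampleLaw P) ≤
      I.card * sampleLaw P E + I.card * (p / 2) := by
    calc _ ≤ ∫⁻ ω, (I.card * E.indicator 1 ω + I.card * (p / 2)) ∂(sampleLaw P) := by
          refine lintegral_mono fun ω => ?_
          by_cases hω : ω ∈ E
          · simp only [Set.indicator_of_mem hω, Pi.one_apply, mul_one]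
            refine le_trans ?_ le_self_add
            exact_mod_cast Finset.card_filter_le _ _
          · simp only [Set.indicator_of_notMem hω, mul_zero, zero_add]
            exact (not_le.1 hω).le
      _ = _ := by
          rw [lintegral_add_right _ measurable_const, lintegral_const_mul' _ _ (by simp),
            lintegral_indicator_one₀ hEm]
          simp
  have hcard : (I.card : ℝ≥0∞) ≠ 0 := by simpa using hI0.ne_empty
  have h2 := hsum.trans hle
  rw [← mul_add, ENNReal.mul_le_mul_iff_right hcard (by simp)] at h2
  have h3 : p / 2 + p / 2 ≤ sampleLaw P E + p / 2 := by rwa [ENNReal.add_halves]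
  have hptop : p / 2 ≠ ⊤ := ENNReal.div_ne_top (measure_ne_top _ _) (by simp)
  exact (ENNReal.add_le_add_iff_right hptop).1 h3

/-- Only the length of the constructed sample matters to this algorithm, not its labels. With
probability at least p/2 the length is at most n/p, and an independent seed at most p/n then returns
the flipped classifier, of error 1. -/
theorem le_expectedError_decayingAlgorithm (hmeas : HasMeasurableTraces C) (hf : f ∈ C)
    (σ : SelectionRule X) (P : ProbabilityMeasure X) {n : ℕ} (hn : 0 < n) :
    ENNReal.ofReal ((P : Measure X).real (disagreementCore C P f) ^ 2 / (2 * n)) ≤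
      (metaAlgorithm0 C σ (decayingAlgorithm f)).expectedError f P n := by
  classical
  set p := (P : Measure X).real (disagreementCore C P f) with hp
  have hp0 : 0 ≤ p := measureReal_nonneg
  have hp1 : p ≤ 1 := measureReal_le_one
  have hn' : (1 : ℝ) ≤ n := by exact_mod_cast hn
  set I := Finset.Ico (n ^ 2) (2 * n ^ 2) with hI
  have hIcard : I.card = n ^ 2 := by rw [hI, Nat.card_Ico]; omega
  have hIa : ∀ i ∈ I, n / 2 ≤ i := fun i hi => by
    have h1 := (Finset.mem_Ico.1 hi).1
    have h2 : n ≤ n ^ 2 := Nat.le_self_pow (by norm_num) n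
    omega
  have hI0 : I.Nonempty := by
    rw [← Finset.card_pos, hIcard]; positivity
  have hhalf := half_measure_disagreementCore_le hmeas hf P hIa hI0
  set E : Set (ℕ → X) := {ω | (I.card : ℝ≥0∞) * ((P : Measure X) (disagreementCore C P f) / 2) ≤
    hitCount I (sampleDisagreement C f (n / 2) ω) ω} with hE
  have hcast : Measurable fun c : ℕ => (c : ℝ≥0∞) := Measurable.of_discrete
  have hEm : NullMeasurableSet E (sampleLaw P) := nullMeasurableSet_le aemeasurable_const
    (hcast.comp_aemeasurable (aemeasurable_hitCount_sampleDisagreement hmeas hf P hIa))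
  let t : unitInterval := ⟨p / n, by positivity, by
    rw [div_le_one (by positivity)]; linarith⟩
  have hreal : (P : Measure X) (disagreementCore C P f) = ENNReal.ofReal p :=
    (ofReal_measureReal (measure_ne_top _ _)).symm
  have hbatch : ∀ ω ∈ E, p * batchSize C f n ω ≤ n := by
    intro ω hω
    rcases hp0.eq_or_lt with h0 | h0
    · rw [← h0, zero_mul]; positivity
    have h1 : (n : ℝ) ^ 2 * (p / 2) ≤ hitCount I (sampleDisagreement C f (n / 2) ω) ω := by
      have h2 : (I.card : ℝ≥0∞) * ((P : Measure X) (disagreementCore C P f) / 2) ≤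
        hitCount I (sampleDisagreement C f (n / 2) ω) ω := hω
      have h3 := ENNReal.toReal_mono (by simp) h2
      rw [hIcard, hreal] at h3
      simpa [ENNReal.toReal_mul, ENNReal.toReal_div, ENNReal.toReal_ofReal hp0] using h3
    have h4 : p ≤ probEstimate n ω (sampleDisagreement C f (n / 2) ω) := by
      rw [probEstimate_eq]
      refine le_trans ?_ (le_max_left _ _)
      rw [div_mul_eq_mul_div, le_div_iff₀ (by positivity)]
      linarith
    have h5 : (batchSize C f n ω : ℝ) ≤
        n / (4 * probEstimate n ω (sampleDisagreement C f (n / 2) ω)) :=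
      Nat.floor_le (div_nonneg (by positivity) (by linarith))
    have h6 : (0 : ℝ) < 4 * probEstimate n ω (sampleDisagreement C f (n / 2) ω) := by linarith
    rw [le_div_iff₀ h6] at h5
    have h7 := mul_le_mul_of_nonneg_right h4 (Nat.cast_nonneg (α := ℝ) (batchSize C f n ω))
    have h8 : 0 ≤ p * batchSize C f n ω := by positivity
    linarith
  refine le_trans ?_ (lintegral_le_outerExpectation _ _)
  calc ENNReal.ofReal (p ^ 2 / (2 * n))
      = ENNReal.ofReal (p / 2) * ENNReal.ofReal (p / n) := by
        rw [← ENNReal.ofReal_mul (by positivity)]; congr 1; field_simp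
    _ ≤ sampleLaw P E * volume (Set.Iic t) := by
        rw [unitInterval.volume_Iic]
        gcongr
        rwa [hreal, show (2 : ℝ≥0∞) = ENNReal.ofReal 2 by simp,
          ← ENNReal.ofReal_div_of_pos two_pos] at hhalf
    _ = ∫⁻ q : (ℕ → X) × unitInterval, (E ×ˢ Set.Iic t).indicator 1 q
          ∂((sampleLaw P).prod volume) := by
        rw [lintegral_indicator_one₀ (hEm.prod measurableSet_Iic.nullMeasurableSet),
          Measure.prod_prod]
    _ ≤ _ := by
        refine lintegral_mono fun q : (ℕ → X) × unitInterval => ?_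
        by_cases hq : q ∈ E ×ˢ Set.Iic t
        swap
        · rw [Set.indicator_of_notMem hq]
          exact zero_le
        rw [Set.indicator_of_mem hq]
        have hq2 : (q.2 : ℝ) ≤ p / n := hq.2
        have hlen : (q.2 : ℝ) * batchSize C f n q.1 ≤ 1 := by
          calc (q.2 : ℝ) * batchSize C f n q.1
              ≤ p / n * batchSize C f n q.1 := by gcongr
            _ ≤ 1 := by
              rw [div_mul_eq_mul_div, div_le_one (by positivity)]
              exact hbatch _ hq.1
        have hrun := (run_metaAlgorithm0 C f σ (decayingAlgorithm f) n q.2 q.1).trans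
          ((learn_decayingAlgorithm f q.2 _).trans (if_pos (by
            rwa [length_run_metaAlgorithm0Sample])))
        exact (errorRate_flipClassifier P f).ge.trans_eq (congrArg (errorRate P f) hrun.symm)

theorem core_null_of_isUniversalActivizer (hmeas : HasMeasurableTraces C) (σ : SelectionRule X)
    (h : IsUniversalActivizer (metaAlgorithm0 C σ) C) (hf : f ∈ C) (P : ProbabilityMeasure X) :
    (P : Measure X) (disagreementCore C P f) = 0 := by
  by_contra hne
  set p := (P : Measure X).real (disagreementCore C P f) with hp
  have hp0 : 0 < p := ENNReal.toReal_pos hne (measure_ne_top _ _)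
  obtain ⟨Λa, hΛa, hact⟩ := h (decayingAlgorithm f) _ (achieves_decayingComplexity C f)
  obtain ⟨c, hc, hlo⟩ := hact f hf P (mem_nontrivialPairs_decayingComplexity f P)
  have hc0 : 0 < c := one_pos.trans_le hc
  have h1 := hlo.eventually_lt_const (u := ENNReal.ofReal (p ^ 2 / (4 * c)))
    (ENNReal.ofReal_pos.2 (by positivity))
  obtain ⟨ε, h2, hε⟩ := (h1.and (Ioo_mem_nhdsGT (show (0 : ℝ) < 1 / c by positivity))).exists
  have hε0 : 0 < ε := hε.1
  have hcε : c * ε < 1 := by rw [mul_comm]; exact (lt_div_iff₀ hc0).1 hε.2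
  have hε1 : ε < 1 := lt_of_le_of_lt (le_mul_of_one_le_left hε0.le hc) hcε
  obtain ⟨hpos, herr⟩ := hΛa f hf P (c * ε) ⟨by positivity, hcε⟩
  -- Use the error bound at the budget equal to the label complexity itself. Together with ⌈1/ε⌉ ≤
  -- 2/ε this keeps the ratio of complexities at least p²/(4c).
  have hlow : ENNReal.ofReal (p ^ 2 / (2 * (c * ε))) ≤ (Λa (c * ε) f P : ℝ≥0∞) := by
    rcases eq_or_ne (Λa (c * ε) f P) ⊤ with htop | htop
    · simp [htop]
    obtain ⟨N, hN⟩ := ENat.ne_top_iff_exists.1 htop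
    rw [← hN] at hpos herr ⊢
    have hN0 : 0 < N := by exact_mod_cast hpos
    have hN0' : (0 : ℝ) < N := by exact_mod_cast hN0
    have h3 := (le_expectedError_decayingAlgorithm hmeas hf σ P hN0).trans (herr N le_rfl)
    rw [ENNReal.ofReal_le_ofReal_iff (by positivity), div_le_iff₀ (by positivity)] at h3
    rw [ENat.toENNReal_coe, ← ENNReal.ofReal_natCast]
    refine ENNReal.ofReal_le_ofReal ?_
    rw [div_le_iff₀ (by positivity)]
    linarith
  simp only [decayingComplexity_self, ENat.toENNReal_coe] at h2
  have hceil : ((⌈1 / ε⌉₊ : ℕ) : ℝ≥0∞) ≤ ENNReal.ofReal (2 / ε) := by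
    rw [← ENNReal.ofReal_natCast]
    refine ENNReal.ofReal_le_ofReal ?_
    have h4 := Nat.ceil_lt_add_one (a := 1 / ε) (by positivity)
    have h5 : 1 ≤ 1 / ε := by rw [le_div_iff₀ hε0]; linarith
    have h6 : 2 / ε = 1 / ε + 1 / ε := by ring
    linarith
  have h7 : ENNReal.ofReal (p ^ 2 / (4 * c)) ≤
      (Λa (c * ε) f P : ℝ≥0∞) / ((⌈1 / ε⌉₊ : ℕ) : ℝ≥0∞) := by
    calc ENNReal.ofReal (p ^ 2 / (4 * c))
        = ENNReal.ofReal (p ^ 2 / (2 * (c * ε))) / ENNReal.ofReal (2 / ε) := by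
          rw [← ENNReal.ofReal_div_of_pos (by positivity)]
          congr 1
          field_simp
          norm_num
      _ ≤ _ := by gcongr
  exact absurd h2 (not_lt.2 h7)

end Lower

theorem mainTheorem3 {X : Type u} [MeasurableSpace X] [StandardBorelSpace X]
    (C : Set (Classifier X)) (hVC : IsVCClass C) (hmeas : HasMeasurableTraces C)
    (σ : SelectionRule X) :
    IsUniversalActivizer (metaAlgorithm0 C σ) C ↔
      ∀ f ∈ C, ∀ P : ProbabilityMeasure X, (P : Measure X) (disagreementCore C P f) = 0 :=
  ⟨fun h _ hf P => core_null_of_isUniversalActivizer hmeas σ h hf P,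
    isUniversalActivizer_of_core_null hVC hmeas σ⟩
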